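/- Let $\mathcal C$ be a smooth curve of length $L>0$ on the torus $\mathbb T^2=\mathbb R^2/\mathbb Z^2$ with nowhere vanishing curvature, and let $\gamma:[0,L]\to\mathcal C$ be a unit speed parametrization (smooth on the closed interval). For an integer $m\ge 1$ put $\mathcal E=\{\mu\in\mathbb Z^2:|\mu|^2=m\}$ and $N_m=\#\mathcal E$. Let $$F(x)=\frac1{\sqrt{N_m}}\sum_{\mu\in\mathcal E}a_\mu e^{2\pi i\langle\mu,x\rangle}$$ be the random Gaussian toral eigenfunction, where the $a_\mu$ are standard complex Gaussian random variables ($\mathbb E a_\mu=0$, $\mathbb E|a_\mu|^2=1$), independent save for the relations $a_{-\mu}=\overline{a_\mu}$, and let $r(t_1,t_2)=\mathbb E[F(\gamma(t_1))F(\gamma(t_2))]$ be the covariance function of $F$ along the curve. Then for every $\epsilon>0$, for all $m\ge1$ with $N_m>0$, $$\int_0^L\!\!\int_0^L r(t_1,t_2)^2\,dt_1dt_2=\frac{L^2}{N_m}+O\left(N_m^{-2+\epsilon}\right),$$ $$\int_0^L\!\!\int_0^L\left|\frac1{2\pi\sqrt m}\frac{\partial r}{\partial t_1}\right|^2dt_1dt_2=\frac{L^2}{2N_m}+O\left(N_m^{-2+\epsilon}\right),$$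 $$\int_0^L\!\!\int_0^L\left|\frac1{4\pi^2m}\frac{\partial^2 r}{\partial t_1\partial t_2}\right|^2dt_1dt_2=\frac{B_{\mathcal C}(\mathcal E)}{N_m}+O\left(N_m^{-2+\epsilon}\right),$$ where $$B_{\mathcal C}(\mathcal E)=\int_0^L\!\!\int_0^L\frac1{N_m}\sum_{\mu\in\mathcal E}\left\langle\frac{\mu}{|\mu|},\dot\gamma(t_1)\right\rangle^2\left\langle\frac{\mu}{|\mu|},\dot\gamma(t_2)\right\rangle^2dt_1dt_2,$$ and the implied constants depend only on $\mathcal C$ and $\epsilon$. -/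

import Mathlib

open MeasureTheory ProbabilityTheory
open scoped ENNReal NNReal ContDiff ComplexConjugate

noncomputable section

namespace NodalTorus

/-- The lattice points `μ ∈ ℤ²` with `|μ|² = m`. The bounding box only serves to make the set a
finset; see `mem_latticePoints`. -/
def latticePoints (m : ℕ) : Finset (Fin 2 → ℤ) :=
  (Finset.Icc (fun _ => -(m : ℤ)) (fun _ => (m : ℤ))).filter
    (fun μ => μ 0 ^ 2 + μ 1 ^ 2 = (m : ℤ))

theorem mem_latticePoints {m : ℕ} {μ : Fin 2 → ℤ} :
    μ ∈ latticePoints m ↔ μ 0 ^ 2 + μ 1 ^ 2 = (m : ℤ) := by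
  simp only [latticePoints, Finset.mem_filter, Finset.mem_Icc, Pi.le_def, Fin.forall_fin_two]
  constructor
  · exact fun h => h.2
  · intro h
    refine ⟨⟨⟨?_, ?_⟩, ⟨?_, ?_⟩⟩, h⟩ <;> nlinarith [sq_nonneg (μ 0), sq_nonneg (μ 1),
      Int.le_self_sq (μ 0), Int.le_self_sq (μ 1), Int.le_self_sq (-μ 0), Int.le_self_sq (-μ 1)]

/-- `N_m`, the number of lattice points on the circle of radius `√m`. -/
def numPoints (m : ℕ) : ℕ := (latticePoints m).card

/-- The integer vector `μ` as a vector of the Euclidean plane. -/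
def toPlane (μ : Fin 2 → ℤ) : EuclideanSpace ℝ (Fin 2) :=
  WithLp.toLp 2 (fun i => (μ i : ℝ))

/-- The unit vector `μ / |μ|`. -/
def direction (μ : Fin 2 → ℤ) : EuclideanSpace ℝ (Fin 2) :=
  ‖toPlane μ‖⁻¹ • toPlane μ

/-- The law of a standard complex Gaussian variable (mean `0`, `𝔼|a|² = 1`): its real and
imaginary parts are independent centred real Gaussians of variance `1/2`. -/
def stdComplexGaussian : Measure ℂ :=
  ((gaussianReal 0 (1 / 2)).prod (gaussianReal 0 (1 / 2))).map Complex.measurableEquivRealProd.symm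

/-- The random coefficients `(a_μ)`, `|μ|² = m`: standard complex Gaussians with
`a_{-μ} = conj a_μ`, and independent save for these relations, i.e. every subfamily that does not
contain both members of a pair `μ, -μ` is independent. (Values of `a` at other indices are
irrelevant.) -/
structure IsWaveCoefficients {Ω : Type*} [MeasurableSpace Ω] (P : Measure Ω) (m : ℕ)
    (a : (Fin 2 → ℤ) → Ω → ℂ) : Prop where
  hasLaw : ∀ μ ∈ latticePoints m, HasLaw (a μ) stdComplexGaussian P
  neg_eq_conj : ∀ μ ∈ latticePoints m, ∀ᵐ w ∂P, a (-μ) w = conj (a μ w)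
  indep : ∀ S : Finset (Fin 2 → ℤ), S ⊆ latticePoints m → (∀ μ ∈ S, -μ ∉ S) →
    iIndepFun (fun (μ : S) => a μ) P

/-- The arithmetic random wave `F(x) = N_m^{-1/2} ∑_{|μ|² = m} a_μ e^{2πi⟨μ,x⟩}` on the torus
`𝕋² = ℝ²/ℤ²`. The sum is almost surely real because `a_{-μ} = conj a_μ`; taking its real part makes
`F` real-valued. -/
def wave {Ω : Type*} (m : ℕ) (a : (Fin 2 → ℤ) → Ω → ℂ) (x : UnitAddTorus (Fin 2)) (w : Ω) : ℝ :=
  (((Real.sqrt (numPoints m) : ℝ) : ℂ)⁻¹ *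
    ∑ μ ∈ latticePoints m, a μ w * UnitAddTorus.mFourier μ x).re

/-- A smooth curve of length `L > 0` on the torus `ℝ²/ℤ²` with a unit speed parametrization
`γ : [0, L] → ℝ²/ℤ²`, given by a smooth lift of `γ` to `ℝ²` (only its values on `[0, L]` matter).
The curve may be closed or not, and may intersect itself. -/
structure SmoothCurve where
  /-- the length `L` -/
  length : ℝ
  length_pos : 0 < length
  /-- the lift of the parametrization to the plane -/
  lift : ℝ → EuclideanSpace ℝ (Fin 2)
  smooth : ContDiffOn ℝ ∞ lift (Set.Icc 0 length)
  unit_speed : ∀ t ∈ Set.Icc 0 length, ‖derivWithin lift (Set.Icc 0 length) t‖ = 1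

namespace SmoothCurve

/-- The parametrization `γ`, with values in the torus. -/
def point (c : SmoothCurve) (t : ℝ) : UnitAddTorus (Fin 2) :=
  fun i => ((c.lift t i : ℝ) : UnitAddCircle)

/-- The velocity `γ̇`. -/
def velocity (c : SmoothCurve) (t : ℝ) : EuclideanSpace ℝ (Fin 2) :=
  derivWithin c.lift (Set.Icc 0 c.length) t

/-- The (unsigned) curvature `|γ̈|` of the unit speed curve. -/
def curvature (c : SmoothCurve) (t : ℝ) : ℝ :=
  ‖derivWithin c.velocity (Set.Icc 0 c.length) t‖

/-- The covariance function `r(t₁, t₂) = 𝔼[F(γ(t₁)) F(γ(t₂))]` along the curve. -/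
def cov (c : SmoothCurve) {Ω : Type*} [MeasurableSpace Ω] (P : Measure Ω) (m : ℕ)
    (a : (Fin 2 → ℤ) → Ω → ℂ) (t₁ t₂ : ℝ) : ℝ :=
  ∫ w, wave m a (c.point t₁) w * wave m a (c.point t₂) w ∂P

/-- The partial derivative `∂h/∂t₁` of a function `h` on `[0, L]²` (one-sided at the ends). -/
def partial₁ (c : SmoothCurve) (h : ℝ → ℝ → ℝ) (t₁ t₂ : ℝ) : ℝ :=
  derivWithin (fun s => h s t₂) (Set.Icc 0 c.length) t₁

/-- The partial derivative `∂h/∂t₂` of a function `h` on `[0, L]²` (one-sided at the ends). -/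
def partial₂ (c : SmoothCurve) (h : ℝ → ℝ → ℝ) (t₁ t₂ : ℝ) : ℝ :=
  derivWithin (fun s => h t₁ s) (Set.Icc 0 c.length) t₂

/-- The double integral `∬ h(t₁, t₂) dt₁ dt₂` over `[0, L]²`. -/
def doubleIntegral (c : SmoothCurve) (h : ℝ → ℝ → ℝ) : ℝ :=
  ∫ t₁ in (0 : ℝ)..c.length, ∫ t₂ in (0 : ℝ)..c.length, h t₁ t₂

/-- `B_𝒞(ℰ) = ∬ N_m⁻¹ ∑_{|μ|² = m} ⟨μ/|μ|, γ̇(t₁)⟩² ⟨μ/|μ|, γ̇(t₂)⟩² dt₁ dt₂`. -/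
def B (c : SmoothCurve) (m : ℕ) : ℝ :=
  c.doubleIntegral fun t₁ t₂ => (1 / (numPoints m : ℝ)) * ∑ μ ∈ latticePoints m,
    (inner ℝ (direction μ) (c.velocity t₁)) ^ 2 * (inner ℝ (direction μ) (c.velocity t₂)) ^ 2

end SmoothCurve

end NodalTorus

end

/-! Since `𝔼 a_μ conj(a_ν)` is `1` for `μ = ν` and `0` otherwise, the covariance is `r(t₁,t₂) = N⁻¹
∑ e(⟨μ, γ(t₁) - γ(t₂)⟩)`, with `e(x) = exp(2πix)`. The normalized derivatives are, up to a factor of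
modulus one, the same sum weighted by the amplitudes `⟨μ/|μ|, γ̇⟩`. Expanding the square modulus and
integrating, each pair `(μ, ν)` contributes `N⁻²` times a product of two oscillatory integrals along
the curve with frequency `μ - ν`, one in `t₁` and one in `t₂`. The diagonal `μ = ν` is exactly the
main term.

Off the diagonal, nonvanishing curvature gives van der Corput decay `O(|μ - ν|^{-1/2})` for each
factor (`exists_norm_osc_le`), so everything reduces to `∑_{μ ≠ ν} 1/|μ - ν| ≪ N^ε`
(`exists_sum_inv_norm_sub_le`).

Write `d = |μ - ν|²`. If `d` exceeds a small power of `m`, the divisor bound `N ≪ m^δ` makes each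
term `O(N⁻²)`, and there are at most `N²` terms. For smaller `d`, at most two pairs share a given
difference and at most `O(√d)` vectors have squared length `d`, so each value of `d` contributes
`O(1)`. It remains to see that there are only `O(N^ε)` such values.

This is arithmetic. The number `d(4m - d)` is a square, and `d` is a sum of two squares, so the
squarefree part of `d` involves only `2` and primes `p ≡ 1 (mod 4)` dividing `m`. These give at most
`2N` square classes, because each split prime at least doubles the number of representations. If the
set of small distances had more than `2N` subsets of size `k`, two of them would have products in
the same class. Their symmetric difference `T` would have even size and square product, and then
`∏_{d ∈ T} (4m - d)` would be a square too. Runge's method rules this out once `m` is polynomially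
large in the elements of `T`. Hence `J` small distances satisfy `choose J k ≤ 2N`, and taking `k ≥
1/ε` gives `J ≪ N^ε`. -/

noncomputable section

namespace NodalTorus

/-! ### Gaussian integers of given norm: upper and lower bounds for their number -/

/-- The Gaussian integers of norm `m`. -/
def normPoints (m : ℕ) : Finset GaussianInt :=
  (latticePoints m).image fun μ => (⟨μ 0, μ 1⟩ : GaussianInt)

theorem mem_normPoints {m : ℕ} {z : GaussianInt} : z ∈ normPoints m ↔ z.norm = (m : ℤ) := by
  simp only [normPoints, Finset.mem_image, mem_latticePoints]
  constructor
  · rintro ⟨μ, h, rfl⟩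
    rw [← h, Zsqrtd.norm_def]
    ring
  · intro h
    refine ⟨![z.re, z.im], ?_, by simp⟩
    rw [← h, Zsqrtd.norm_def]
    simp only [Matrix.cons_val_zero, Matrix.cons_val_one]
    ring

theorem card_normPoints (m : ℕ) : (normPoints m).card = numPoints m := by
  refine Finset.card_image_of_injective _ fun μ ν h => ?_
  simp only [Zsqrtd.ext_iff] at h
  ext i
  fin_cases i
  · exact h.1
  · exact h.2

theorem prime_of_norm_eq_prime {p : ℕ} (hp : p.Prime) {w : GaussianInt} (hw : w.norm = (p : ℤ)) :
    Prime w := by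
  refine Irreducible.prime ⟨fun h => ?_, fun a b hab => ?_⟩
  · have := Zsqrtd.norm_eq_one_iff.mpr h
    rw [hw, Int.natAbs_natCast] at this
    exact hp.one_lt.ne' this
  · have h : a.norm.natAbs * b.norm.natAbs = p := by
      rw [← Int.natAbs_mul, ← Zsqrtd.norm_mul, ← hab, hw, Int.natAbs_natCast]
    rcases Nat.prime_mul_iff.mp (h ▸ hp) with ⟨_, hb⟩ | ⟨_, ha⟩
    · exact Or.inr (Zsqrtd.norm_eq_one_iff.mp hb)
    · exact Or.inl (Zsqrtd.norm_eq_one_iff.mp ha)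

theorem exists_norm_eq_prime {p : ℕ} (hp : p.Prime) (h4 : p % 4 ≠ 3) :
    ∃ w : GaussianInt, w.norm = (p : ℤ) := by
  have := Fact.mk hp
  obtain ⟨a, b, hab⟩ := Nat.Prime.sq_add_sq h4
  refine ⟨⟨a, b⟩, ?_⟩
  rw [Zsqrtd.norm_def, ← hab]
  push_cast
  ring

theorem norm_star (w : GaussianInt) : (star w).norm = w.norm := by
  simp [Zsqrtd.norm_def]

/-- The Gaussian prime `w` divides `p`, hence `z * star z`, hence one of the two factors. -/
theorem exists_eq_mul_of_norm {p n : ℕ} (hp : p.Prime) {w z : GaussianInt} (hw : w.norm = (p : ℤ))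
    (hz : z.norm = (p * n : ℕ)) :
    ∃ z' : GaussianInt, z'.norm = (n : ℤ) ∧ (z = w * z' ∨ z = star w * z') := by
  have hP := prime_of_norm_eq_prime hp hw
  have hp0 : (p : ℤ) ≠ 0 := by exact_mod_cast hp.ne_zero
  have key : ∀ v : GaussianInt, v.norm = (p : ℤ) → ∀ z', z = v * z' → z'.norm = (n : ℤ) := by
    intro v hv z' h
    rw [h, Zsqrtd.norm_mul, hv] at hz
    push_cast at hz
    exact mul_left_cancel₀ hp0 hz
  have hd : w ∣ z * star z := by
    rw [← Zsqrtd.norm_eq_mul_conj, hz]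
    refine Dvd.intro (star w * n) ?_
    rw [← mul_assoc, ← Zsqrtd.norm_eq_mul_conj, hw]
    push_cast
    ring
  rcases hP.dvd_or_dvd hd with ⟨z', h⟩ | ⟨z', h⟩
  · exact ⟨z', key w hw z' h, Or.inl h⟩
  · have h' : z = star w * star z' := by
      rw [← star_star z, h, star_mul, mul_comm]
    exact ⟨star z', key _ (by rw [norm_star, hw]) _ h', Or.inr h'⟩

theorem exists_eq_pow_mul_of_norm {p : ℕ} (hp : p.Prime) {w : GaussianInt}
    (hw : w.norm = (p : ℤ)) (k n : ℕ) {z : GaussianInt} (hz : z.norm = (p ^ k * n : ℕ)) :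
    ∃ i ∈ Finset.range (k + 1), ∃ z' : GaussianInt, z'.norm = (n : ℤ) ∧
      z = w ^ i * star w ^ (k - i) * z' := by
  induction k generalizing z with
  | zero => exact ⟨0, by simp, z, by simpa using hz, by simp⟩
  | succ k ih =>
    obtain ⟨z₁, h₁, h⟩ := exists_eq_mul_of_norm hp hw (n := p ^ k * n) (z := z)
      (by rw [hz]; congr 1; ring)
    obtain ⟨i, hi, z', h', rfl⟩ := ih h₁
    simp only [Finset.mem_range] at hi
    rcases h with h | h
    · refine ⟨i + 1, by simp; omega, z', h', ?_⟩
      rw [h, Nat.add_sub_add_right]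
      ring
    · refine ⟨i, by simp; omega, z', h', ?_⟩
      rw [h, Nat.sub_add_comm (by omega : i ≤ k)]
      ring

/-- Only the number `i ≤ k` of factors `w`, as opposed to `star w`, is free once the cofactor is
fixed. The ramified prime `2` is included, since overcounting does no harm here. -/
theorem card_normPoints_pow_mul_le {p : ℕ} (hp : p.Prime) (h4 : p % 4 ≠ 3) (k n : ℕ) :
    (normPoints (p ^ k * n)).card ≤ (k + 1) * (normPoints n).card := by
  obtain ⟨w, hw⟩ := exists_norm_eq_prime hp h4
  have hsub : normPoints (p ^ k * n) ⊆ (Finset.range (k + 1)).biUnion fun i =>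
      (normPoints n).image fun z' => w ^ i * star w ^ (k - i) * z' := by
    intro z hz
    obtain ⟨i, hi, z', h', h⟩ := exists_eq_pow_mul_of_norm hp hw k n (mem_normPoints.mp hz)
    exact Finset.mem_biUnion.mpr ⟨i, hi, Finset.mem_image.mpr ⟨z', mem_normPoints.mpr h', h.symm⟩⟩
  refine (Finset.card_le_card hsub).trans ((Finset.card_biUnion_le_card_mul _ _
    (normPoints n).card fun i _ => Finset.card_image_le).trans (by simp))

theorem exists_eq_natCast_mul_of_norm {p m : ℕ} (hp : p.Prime) (h4 : p % 4 = 3)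
    (hpm : p ∣ m) {z : GaussianInt} (hz : z.norm = (m : ℤ)) : ∃ z' : GaussianInt, z = p * z' := by
  have := Fact.mk hp
  have hP := GaussianInt.prime_of_nat_prime_of_mod_four_eq_three p h4
  have hd : (p : GaussianInt) ∣ z * star z := by
    rw [← Zsqrtd.norm_eq_mul_conj, hz]
    rw [Int.cast_natCast]
    exact Nat.cast_dvd_cast hpm
  rcases hP.dvd_or_dvd hd with h | ⟨z', h⟩
  · exact h
  · refine ⟨star z', ?_⟩
    rw [← star_star z, h, star_mul, star_natCast, mul_comm]

/-- An inert prime dividing the norm divides the Gaussian integer itself, so it can be factored out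
and the norm loses `p ^ 2`. -/
theorem card_normPoints_le_of_mod_four_eq_three {p m : ℕ} (hp : p.Prime) (h4 : p % 4 = 3)
    (hpm : p ∣ m) (hne : (normPoints m).Nonempty) :
    ∃ n, m = p ^ 2 * n ∧ (normPoints m).card ≤ (normPoints n).card := by
  have hp0 : (p : ℤ) ≠ 0 := by exact_mod_cast hp.ne_zero
  have key : ∀ z ∈ normPoints m, ∃ z' : GaussianInt, z = p * z' ∧ (m : ℤ) = p ^ 2 * z'.norm := by
    intro z hz
    rw [mem_normPoints] at hz
    obtain ⟨z', h⟩ := exists_eq_natCast_mul_of_norm hp h4 hpm hz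
    refine ⟨z', h, ?_⟩
    rw [← hz, h, Zsqrtd.norm_mul, Zsqrtd.norm_natCast]
    ring
  obtain ⟨z₀, hz₀⟩ := hne
  obtain ⟨z₁, -, h₁⟩ := key z₀ hz₀
  have hm : m = p ^ 2 * z₁.norm.natAbs := by
    zify
    rw [abs_of_nonneg (GaussianInt.norm_nonneg _), h₁]
  refine ⟨z₁.norm.natAbs, hm, ?_⟩
  have hsub : normPoints m ⊆ (normPoints z₁.norm.natAbs).image fun z' => (p : GaussianInt) * z' := by
    intro z hz
    obtain ⟨z', h, h'⟩ := key z hz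
    refine Finset.mem_image.mpr ⟨z', mem_normPoints.mpr ?_, h.symm⟩
    rw [GaussianInt.abs_natCast_norm]
    exact mul_left_cancel₀ (pow_ne_zero 2 hp0) (h'.symm.trans h₁)
  exact (Finset.card_le_card hsub).trans Finset.card_image_le

theorem card_normPoints_one_le : (normPoints 1).card ≤ 4 := by
  have hsub : normPoints 1 ⊆ ({⟨1, 0⟩, ⟨-1, 0⟩, ⟨0, 1⟩, ⟨0, -1⟩} : Finset GaussianInt) := by
    rintro ⟨x, y⟩ h
    rw [mem_normPoints, Zsqrtd.norm_def] at h
    push_cast at h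
    have hx1 : x ≤ 1 := by nlinarith [sq_nonneg y]
    have hx2 : -1 ≤ x := by nlinarith [sq_nonneg y]
    have hy1 : y ≤ 1 := by nlinarith [sq_nonneg x]
    have hy2 : -1 ≤ y := by nlinarith [sq_nonneg x]
    interval_cases x <;> interval_cases y <;> simp_all
  exact (Finset.card_le_card hsub).trans Finset.card_le_four

/-- Strip the smallest prime: a factor `p ^ k` with `p` not inert costs `k + 1`, exactly its share
of the divisor count, and an inert prime costs nothing. The `4` counts the units. -/
theorem card_normPoints_le_card_divisors {m : ℕ} (hm : m ≠ 0) :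
    (normPoints m).card ≤ 4 * m.divisors.card := by
  induction m using Nat.strong_induction_on with
  | _ m ih =>
    rcases eq_or_ne m 1 with rfl | h1
    · simpa using card_normPoints_one_le
    have hp := Nat.minFac_prime h1
    set p := m.minFac
    have hpm : p ∣ m := Nat.minFac_dvd m
    by_cases h4 : p % 4 = 3
    · rcases (normPoints m).eq_empty_or_nonempty with he | hne
      · simp [he]
      obtain ⟨n, hmn, hle⟩ := card_normPoints_le_of_mod_four_eq_three hp h4 hpm hne
      have hn : n ≠ 0 := by rintro rfl; exact hm (by simpa using hmn)
      have hlt : n < m := by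
        rw [hmn]
        exact lt_mul_left (Nat.pos_of_ne_zero hn) (Nat.one_lt_pow two_ne_zero hp.one_lt)
      refine hle.trans ((ih n hlt hn).trans (Nat.mul_le_mul_left _ (Finset.card_le_card ?_)))
      exact Nat.divisors_subset_of_dvd hm (hmn ▸ Dvd.intro_left _ rfl)
    · obtain ⟨k, n, hpn, hmn⟩ := Nat.exists_eq_pow_mul_and_not_dvd hm p hp.ne_one
      have hn : n ≠ 0 := by rintro rfl; exact hm (by simpa using hmn)
      have hk : k ≠ 0 := by rintro rfl; rw [hmn, pow_zero, one_mul] at hpm; exact hpn hpm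
      have hlt : n < m := by
        rw [hmn]
        exact lt_mul_left (Nat.pos_of_ne_zero hn) (Nat.one_lt_pow hk hp.one_lt)
      have hco : Nat.Coprime (p ^ k) n := ((Nat.Prime.coprime_iff_not_dvd hp).mpr hpn).pow_left k
      rw [hmn, Nat.Coprime.card_divisors_mul hco, Nat.divisors_prime_pow hp, Finset.card_map,
        Finset.card_range]
      calc _ ≤ (k + 1) * (normPoints n).card := card_normPoints_pow_mul_le hp h4 k n
        _ ≤ (k + 1) * (4 * n.divisors.card) := Nat.mul_le_mul_left _ (ih n hlt hn)
        _ = _ := by ring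

/-- Multiplication by `w ^ k` and by `star w ^ k` are two injections from norm `n` to norm `p ^ k *
n`. A common value would force `w` to divide `star w` or an element of norm `n`, and neither is
possible. -/
theorem two_mul_card_normPoints_le {p k n : ℕ} (hp : p.Prime) (h4 : p % 4 = 1) (hk : k ≠ 0)
    (hpn : ¬ p ∣ n) : 2 * (normPoints n).card ≤ (normPoints (p ^ k * n)).card := by
  obtain ⟨w, hw⟩ := exists_norm_eq_prime hp (by omega)
  have hP := prime_of_norm_eq_prime hp hw
  have hP' := prime_of_norm_eq_prime hp ((norm_star w).trans hw)
  -- If `w ∣ star w`, then `w` divides `w + star w = 2 Re w`. Taking norms, the odd prime `p`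
  -- divides the real part, then the imaginary part, so `p ^ 2` would divide the norm `p`.
  have hndvd : ¬ w ∣ star w := by
    rintro hd
    have h1 : w ∣ (2 * w.re : ℤ) := by
      have h2 : ((2 * w.re : ℤ) : GaussianInt) = w + star w := by
        ext <;> simp [two_mul]
      rw [h2]
      exact dvd_add dvd_rfl hd
    obtain ⟨v, hv⟩ := h1
    have h3 : (2 * w.re) * (2 * w.re) = (p : ℤ) * v.norm := by
      rw [← hw, ← Zsqrtd.norm_mul, ← hv, Zsqrtd.norm_intCast]
    have hpZ : Prime (p : ℤ) := Nat.prime_iff_prime_int.mp hp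
    have h5 : (p : ℤ) ∣ 2 * w.re := (hpZ.dvd_or_dvd (Dvd.intro _ h3.symm)).elim id id
    have hre : (p : ℤ) ∣ w.re := by
      rcases hpZ.dvd_or_dvd h5 with h | h
      · have := Int.le_of_dvd two_pos h
        have := hp.two_le
        omega
      · exact h
    rw [Zsqrtd.norm_def] at hw
    have him : (p : ℤ) ∣ w.im := by
      have : (p : ℤ) ∣ w.im * w.im :=
        ⟨1 - (w.re / p) * w.re, by
          have := Int.ediv_mul_cancel hre
          linear_combination hw + w.re * this⟩
      exact (hpZ.dvd_or_dvd this).elim id id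
    obtain ⟨a, ha⟩ := hre
    obtain ⟨b, hb⟩ := him
    have h6 : (p : ℤ) * (a * a + b * b) = 1 := by
      have hp0 : (p : ℤ) ≠ 0 := by exact_mod_cast hp.ne_zero
      apply mul_left_cancel₀ hp0
      rw [ha, hb] at hw
      linear_combination hw
    have := Int.eq_one_of_mul_eq_one_right (by positivity) h6
    have := hp.one_lt
    omega
  have hdisj : Disjoint ((normPoints n).image fun z => w ^ k * z)
      ((normPoints n).image fun z => star w ^ k * z) := by
    rw [Finset.disjoint_left]
    rintro z hz hz'
    obtain ⟨z₁, _, rfl⟩ := Finset.mem_image.mp hz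
    obtain ⟨z₂, h₂, h⟩ := Finset.mem_image.mp hz'
    have hd : w ∣ star w ^ k * z₂ := by
      rw [h]
      exact (dvd_pow_self w hk).mul_right _
    rcases hP.dvd_or_dvd hd with hd | ⟨v, hv⟩
    · exact hndvd (hP.dvd_of_dvd_pow hd)
    · apply hpn
      rw [mem_normPoints, hv, Zsqrtd.norm_mul, hw] at h₂
      exact Int.natCast_dvd_natCast.mp (Dvd.intro _ h₂)
  have hsub : ((normPoints n).image fun z => w ^ k * z) ∪
      ((normPoints n).image fun z => star w ^ k * z) ⊆ normPoints (p ^ k * n) := by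
    have hpow : ∀ v : GaussianInt, (v ^ k).norm = v.norm ^ k := fun v =>
      map_pow Zsqrtd.normMonoidHom v k
    apply Finset.union_subset <;>
    · intro z hz
      obtain ⟨z₁, h₁, rfl⟩ := Finset.mem_image.mp hz
      rw [mem_normPoints] at h₁ ⊢
      rw [Zsqrtd.norm_mul, hpow, h₁]
      simp only [norm_star, hw]
      push_cast
      ring
  have hcard := Finset.card_le_card hsub
  rw [Finset.card_union_of_disjoint hdisj,
    Finset.card_image_of_injective _ (mul_right_injective₀ (pow_ne_zero k hP.ne_zero)),
    Finset.card_image_of_injective _ (mul_right_injective₀ (pow_ne_zero k hP'.ne_zero))] at hcard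
  omega

/-- Induction removing one split prime at a time, each of which at least doubles the count. -/
theorem two_pow_card_filter_le_card_normPoints {m : ℕ} (hm : m ≠ 0)
    (hne : (normPoints m).Nonempty) :
    2 ^ (m.primeFactors.filter fun p => p % 4 = 1).card ≤ (normPoints m).card := by
  induction m using Nat.strong_induction_on with
  | _ m ih =>
    rcases (m.primeFactors.filter fun p => p % 4 = 1).eq_empty_or_nonempty with he | ⟨p, hp⟩
    · rw [he]
      simpa using hne
    rw [Finset.mem_filter, Nat.mem_primeFactors] at hp
    obtain ⟨⟨hp, hpm, -⟩, h4⟩ := hp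
    obtain ⟨k, n, hpn, hmn⟩ := Nat.exists_eq_pow_mul_and_not_dvd hm p hp.ne_one
    have hn : n ≠ 0 := by rintro rfl; exact hm (by simpa using hmn)
    have hk : k ≠ 0 := by rintro rfl; rw [hmn, pow_zero, one_mul] at hpm; exact hpn hpm
    have hlt : n < m := by
      rw [hmn]
      exact lt_mul_left (Nat.pos_of_ne_zero hn) (Nat.one_lt_pow hk hp.one_lt)
    -- Nonemptiness passes down to `n` because of the upper bound by `(k + 1)` times the count for
    -- `n`.
    have hnen : (normPoints n).Nonempty := by
      have h := card_normPoints_pow_mul_le hp (by omega) k n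
      rw [← hmn] at h
      rw [← Finset.card_pos] at hne ⊢
      exact Nat.pos_of_mul_pos_left (hne.trans_le h)
    have hsub : (m.primeFactors.filter fun p => p % 4 = 1) ⊆
        insert p (n.primeFactors.filter fun p => p % 4 = 1) := by
      intro q hq
      rw [Finset.mem_filter, Nat.mem_primeFactors] at hq
      rw [Finset.mem_insert, Finset.mem_filter, Nat.mem_primeFactors]
      obtain ⟨⟨hqp, hqm, -⟩, hq4⟩ := hq
      rw [hmn, hqp.dvd_mul] at hqm
      rcases hqm with h | h
      · exact Or.inl ((Nat.prime_dvd_prime_iff_eq hqp hp).mp (hqp.dvd_of_dvd_pow h))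
      · exact Or.inr ⟨⟨hqp, h, hn⟩, hq4⟩
    calc _ ≤ 2 ^ ((n.primeFactors.filter fun p => p % 4 = 1).card + 1) :=
          Nat.pow_le_pow_right two_pos
            ((Finset.card_le_card hsub).trans (Finset.card_insert_le _ _))
      _ = 2 * 2 ^ (n.primeFactors.filter fun p => p % 4 = 1).card := by ring
      _ ≤ 2 * (normPoints n).card := Nat.mul_le_mul_left _ (ih n hlt hn hnen)
      _ ≤ _ := by
          conv_rhs => rw [hmn]
          exact two_mul_card_normPoints_le hp h4 hk hpn

/-! ### The divisor bound and its consequence for the number of lattice points -/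

/-- The divisor bound. -/
theorem exists_card_divisors_le_rpow {δ : ℝ} (hδ : 0 < δ) :
    ∃ C : ℝ, 0 < C ∧ ∀ m : ℕ, m ≠ 0 → (m.divisors.card : ℝ) ≤ C * (m : ℝ) ^ δ := by
  -- For `p ≥ P` one has `p ^ δ ≥ 2`, so `a + 1 ≤ 2 ^ a ≤ p ^ (δ a)` without loss. Each of the fewer
  -- than `P` smaller primes loses at most the factor `c`, which comes from `2 ^ (δ a) ≥ 1 + a δ log
  -- 2`.
  set P : ℕ := ⌈(2 : ℝ) ^ (1 / δ)⌉₊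
  set c : ℝ := 1 + 1 / (δ * Real.log 2)
  have hlog : 0 < Real.log 2 := Real.log_pos one_lt_two
  have hc : 1 ≤ c := le_add_of_nonneg_right (by positivity)
  refine ⟨c ^ P, by positivity, fun m hm => ?_⟩
  have hlocal : ∀ p ∈ m.primeFactors, ((m.factorization p + 1 : ℕ) : ℝ) ≤
      (if p < P then c else 1) * ((p : ℝ) ^ m.factorization p) ^ δ := by
    intro p hp
    have hp2 : (2 : ℝ) ≤ p := by exact_mod_cast (Nat.prime_of_mem_primeFactors hp).two_le
    set a := m.factorization p
    have hcomm : ((p : ℝ) ^ a) ^ δ = ((p : ℝ) ^ δ) ^ a := by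
      rw [← Real.rpow_natCast, ← Real.rpow_natCast, ← Real.rpow_mul (by positivity),
        ← Real.rpow_mul (by positivity), mul_comm]
    rw [hcomm]
    split_ifs with h
    · have h1 : ((2 : ℝ) ^ δ) ^ a ≤ ((p : ℝ) ^ δ) ^ a := by gcongr
      have h2 : 1 + a * (δ * Real.log 2) ≤ ((2 : ℝ) ^ δ) ^ a := by
        have : (2 : ℝ) ^ δ = Real.exp (δ * Real.log 2) := by
          rw [Real.rpow_def_of_pos two_pos, mul_comm]
        rw [this, ← Real.exp_nat_mul]
        linarith [Real.add_one_le_exp (a * (δ * Real.log 2))]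
      have h3 : ((a + 1 : ℕ) : ℝ) ≤ c * (1 + a * (δ * Real.log 2)) := by
        have : c * (1 + a * (δ * Real.log 2)) =
            1 + 1 / (δ * Real.log 2) + a * (δ * Real.log 2) + a := by
          simp only [c]
          field_simp
          ring
        rw [this]
        push_cast
        have : 0 ≤ 1 / (δ * Real.log 2) + a * (δ * Real.log 2) := by positivity
        linarith
      exact h3.trans (mul_le_mul_of_nonneg_left (h2.trans h1) (by positivity))
    · have h1 : (2 : ℝ) ≤ (p : ℝ) ^ δ := by
        have h2 : (2 : ℝ) ^ (1 / δ) ≤ p := (Nat.le_ceil _).trans (by exact_mod_cast not_lt.mp h)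
        calc (2 : ℝ) = ((2 : ℝ) ^ (1 / δ)) ^ δ := by
              rw [← Real.rpow_mul two_pos.le, one_div_mul_cancel hδ.ne', Real.rpow_one]
          _ ≤ _ := by gcongr
      have h2 : ((a + 1 : ℕ) : ℝ) ≤ (2 : ℝ) ^ a := by exact_mod_cast Nat.lt_two_pow_self
      rw [one_mul]
      exact h2.trans (by gcongr)
  have hprod : (m : ℝ) ^ δ = ∏ p ∈ m.primeFactors, ((p : ℝ) ^ m.factorization p) ^ δ := by
    rw [Real.finsetProd_rpow _ _ fun i _ => by positivity]
    congr 1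
    conv_lhs => rw [← Nat.prod_factorization_pow_eq_self hm]
    rw [Finsupp.prod, Nat.support_factorization]
    push_cast
    rfl
  rw [Nat.card_divisors hm, hprod]
  push_cast
  calc ∏ p ∈ m.primeFactors, ((m.factorization p : ℝ) + 1)
      ≤ ∏ p ∈ m.primeFactors,
        (if p < P then c else 1) * ((p : ℝ) ^ m.factorization p) ^ δ :=
        Finset.prod_le_prod (fun _ _ => by positivity) fun p hp => by
          exact_mod_cast hlocal p hp
    _ = (∏ p ∈ m.primeFactors, if p < P then c else 1) *
        ∏ p ∈ m.primeFactors, ((p : ℝ) ^ m.factorization p) ^ δ := Finset.prod_mul_distrib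
    _ ≤ _ := by
        refine mul_le_mul_of_nonneg_right ?_ (Finset.prod_nonneg fun _ _ => by positivity)
        rw [Finset.prod_ite, Finset.prod_const, Finset.prod_const_one, mul_one]
        refine pow_le_pow_right₀ hc ?_
        calc _ ≤ (Finset.range P).card := Finset.card_le_card fun p hp => by
              simpa using (Finset.mem_filter.mp hp).2
          _ = P := Finset.card_range P

theorem exists_numPoints_le_rpow {δ : ℝ} (hδ : 0 < δ) :
    ∃ C : ℝ, 0 < C ∧ ∀ m : ℕ, m ≠ 0 → (numPoints m : ℝ) ≤ C * (m : ℝ) ^ δ := by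
  obtain ⟨C, hC, h⟩ := exists_card_divisors_le_rpow hδ
  refine ⟨4 * C, by positivity, fun m hm => ?_⟩
  have h1 : (numPoints m : ℝ) ≤ 4 * m.divisors.card := by
    rw [← card_normPoints]
    exact_mod_cast card_normPoints_le_card_divisors hm
  linarith [h m hm]

/-! ### Runge's method for products of distinct linear factors -/

open Polynomial in
/-- Up to powers of `4`, a monic polynomial of degree `2k` has an approximate square root: the
first `j` coefficients of the remainder below the leading one can be made to vanish. -/
theorem exists_approx_sqrt {A : Type*} [CommRing A] {k : ℕ} {P : A[X]} (hP : P.Monic)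
    (hdeg : P.natDegree = 2 * k) (j : ℕ) (hj : j ≤ k) :
    ∃ (c : ℕ) (Q : A[X]), Q.natDegree ≤ k ∧ Q.coeff k = 2 ^ c ∧
      (C (2 ^ c) ^ 2 * P - Q ^ 2).degree < ((2 * k - j : ℕ) : WithBot ℕ) := by
  induction j with
  | zero =>
    refine ⟨0, X ^ k, natDegree_X_pow_le k, by simp, ?_⟩
    have h1 : (P : A[X]).degree ≤ ((2 * k : ℕ) : WithBot ℕ) := hdeg ▸ degree_le_natDegree
    rw [degree_lt_iff_coeff_zero]
    intro n hn
    rw [Nat.sub_zero] at hn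
    simp only [pow_zero, map_one, one_pow, one_mul, coeff_sub, ← pow_mul, coeff_X_pow]
    rcases hn.eq_or_lt with rfl | hn
    · rw [← hdeg, coeff_natDegree, hP.leadingCoeff, hdeg, mul_comm]
      simp
    · rw [coeff_eq_zero_of_natDegree_lt (hdeg ▸ hn), if_neg (by omega), sub_zero]
  | succ j ih =>
    obtain ⟨c, Q, hQ, hlead, hE⟩ := ih (by omega)
    set E := C (2 ^ c) ^ 2 * P - Q ^ 2 with hEdef
    set e := E.coeff (2 * k - 1 - j)
    -- The rescaled remainder has top coefficient `(2 ^ (c + 1)) ^ 2 * e`. The cross term in the new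
    -- square has top coefficient `2 ^ (c + 2) * e * 2 ^ c`, which cancels it. The powers of `2`
    -- avoid dividing by the leading coefficient of `2 * Q`.
    refine ⟨2 * c + 1, C (2 ^ (c + 1)) * Q + C e * X ^ (k - 1 - j), ?_, ?_, ?_⟩
    · refine natDegree_add_le_of_degree_le ((natDegree_C_mul_le _ _).trans hQ) ?_
      exact (natDegree_C_mul_X_pow_le _ _).trans (by omega)
    · rw [coeff_add, coeff_C_mul, hlead, coeff_C_mul, coeff_X_pow, if_neg (by omega)]
      ring
    · have hexp : C (2 ^ (2 * c + 1)) ^ 2 * P - (C (2 ^ (c + 1)) * Q + C e * X ^ (k - 1 - j)) ^ 2 =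
          C (2 ^ (c + 1)) ^ 2 * E - C (2 ^ (c + 2) * e) * (Q * X ^ (k - 1 - j)) -
            C (e ^ 2) * X ^ (2 * (k - 1 - j)) := by
        simp only [hEdef, map_mul, map_pow, map_ofNat]
        ring
      rw [hexp, degree_lt_iff_coeff_zero]
      intro n hn
      rw [coeff_sub, coeff_sub, ← map_pow, coeff_C_mul, coeff_C_mul, coeff_C_mul, coeff_X_pow,
        coeff_mul_X_pow', if_neg (by omega : ¬ n = 2 * (k - 1 - j)), if_pos (by omega)]
      rcases (by omega : n = 2 * k - 1 - j ∨ 2 * k - j ≤ n) with rfl | hn'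
      · have h1 : 2 * k - 1 - j - (k - 1 - j) = k := by omega
        rw [h1, hlead]
        ring
      · rw [(degree_lt_iff_coeff_zero _ _).mp hE n hn',
          coeff_eq_zero_of_natDegree_lt (by omega : Q.natDegree < n - (k - 1 - j))]
        ring

/-- Used for the coefficients of the Runge remainder, which are integer polynomials in the roots; it
makes the final threshold polynomial in the size of the roots. -/
theorem exists_abs_eval_le {σ : Type*} (f : MvPolynomial σ ℤ) :
    ∃ C e : ℕ, ∀ (d : σ → ℤ) (H : ℤ), 1 ≤ H → (∀ i, |d i| ≤ H) →
      |MvPolynomial.eval d f| ≤ C * H ^ e := by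
  induction f using MvPolynomial.induction_on with
  | C a => exact ⟨a.natAbs, 0, fun d H _ _ => by simp⟩
  | add p q hp hq =>
    obtain ⟨C₁, e₁, h₁⟩ := hp
    obtain ⟨C₂, e₂, h₂⟩ := hq
    refine ⟨C₁ + C₂, e₁ + e₂, fun d H hH hd => ?_⟩
    have a₁ : H ^ e₁ ≤ H ^ (e₁ + e₂) := pow_le_pow_right₀ hH (by omega)
    have a₂ : H ^ e₂ ≤ H ^ (e₁ + e₂) := pow_le_pow_right₀ hH (by omega)
    rw [map_add]
    calc _ ≤ _ := abs_add_le _ _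
      _ ≤ C₁ * H ^ e₁ + C₂ * H ^ e₂ := add_le_add (h₁ d H hH hd) (h₂ d H hH hd)
      _ ≤ C₁ * H ^ (e₁ + e₂) + C₂ * H ^ (e₁ + e₂) := by gcongr
      _ = _ := by push_cast; ring
  | mul_X p i hp =>
    obtain ⟨C, e, h⟩ := hp
    refine ⟨C, e + 1, fun d H hH hd => ?_⟩
    rw [map_mul, MvPolynomial.eval_X, abs_mul, pow_succ, ← mul_assoc]
    exact mul_le_mul (h d H hH hd) (hd i) (abs_nonneg _) (by positivity)

open Polynomial in
/-- An integer at which a nonzero polynomial with integer coefficients vanishes is bounded by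
the largest coefficient. -/
theorem le_of_eval_eq_zero {E : ℤ[X]} (hE : E ≠ 0) {x M : ℤ} (hM : ∀ i, |E.coeff i| ≤ M)
    (hx : E.eval x = 0) : x ≤ M := by
  -- After removing the power of `X`, a positive integer root divides the nonzero constant term.
  obtain ⟨E', hE', h0⟩ : ∃ E' : ℤ[X], E = X ^ E.natTrailingDegree * E' ∧ E'.coeff 0 ≠ 0 := by
    obtain ⟨E', h⟩ := (X_pow_dvd_iff (f := E)).mpr fun d hd => coeff_eq_zero_of_lt_natTrailingDegree hd
    refine ⟨E', h, ?_⟩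
    have h1 : E.coeff E.natTrailingDegree ≠ 0 := trailingCoeff_nonzero_iff_nonzero.mpr hE
    intro h2
    apply h1
    conv_lhs => arg 1; rw [h]
    rw [coeff_X_pow_mul', if_pos le_rfl, Nat.sub_self, h2]
  have hb : |E'.coeff 0| ≤ M := by
    have := hM E.natTrailingDegree
    conv_lhs at this => arg 1; arg 1; rw [hE']
    rwa [coeff_X_pow_mul', if_pos le_rfl, Nat.sub_self] at this
  rcases le_or_gt x 0 with hx0 | hx0
  · exact hx0.trans ((abs_nonneg _).trans hb)
  rw [hE', eval_mul, eval_pow, eval_X] at hx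
  have hx' : E'.eval x = 0 := (mul_eq_zero.mp hx).resolve_left (pow_ne_zero _ hx0.ne')
  have hdvd : x ∣ E'.coeff 0 := by
    have h := sub_dvd_eval_sub x 0 E'
    rwa [hx', sub_zero, zero_sub, dvd_neg, ← coeff_zero_eq_eval_zero] at h
  exact (Int.le_of_dvd (abs_pos.mpr h0) ((dvd_abs _ _).mpr hdvd)).trans hb

open Polynomial in
/-- Runge's method: a product of an even number of distinct linear factors takes no square values
at integers that are polynomially large in terms of the roots. -/
theorem not_isSquare_prod_sub {k : ℕ} (hk : 0 < k) :
    ∃ C e : ℕ, ∀ d : Fin (2 * k) → ℤ, Function.Injective d → ∀ H : ℤ, 1 ≤ H →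
      (∀ i, |d i| ≤ H) → ∀ x : ℤ, C * H ^ e < x → ¬ IsSquare (∏ i, (x - d i)) := by
  -- The roots are treated as indeterminates, so that a single approximate square root serves all
  -- choices of `d` and the constants do not depend on `d`.
  let A := MvPolynomial (Fin (2 * k)) ℤ
  let P : A[X] := ∏ i, (Polynomial.X - Polynomial.C (MvPolynomial.X i : A))
  have hPm : P.Monic := monic_prod_X_sub_C _ _
  have hPd : P.natDegree = 2 * k := by
    rw [natDegree_finsetProd_X_sub_C_eq_card]
    simp
  obtain ⟨c, Q, hQ, hlead, hdeg⟩ := exists_approx_sqrt hPm hPd k le_rfl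
  set E := Polynomial.C (2 ^ c) ^ 2 * P - Q ^ 2 with hEdef
  choose B b hB using fun i : ℕ => exists_abs_eval_le (E.coeff i)
  set B₀ := ∑ i ∈ Finset.range k, B i
  set b₀ := ∑ i ∈ Finset.range k, b i
  refine ⟨2 ^ k * k * B₀ + B₀ + 2, b₀ + 1, fun d hd H hH hdH x hx hsq => ?_⟩
  set φ : A →+* ℤ := MvPolynomial.eval d
  set M : ℤ := B₀ * H ^ b₀
  have hM0 : 0 ≤ M := by positivity
  have hcoeff : ∀ i, |(E.map φ).coeff i| ≤ M := by
    intro i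
    rw [coeff_map]
    by_cases hi : i < k
    · refine (hB i d H hH hdH).trans ?_
      have h1 : B i ≤ B₀ := Finset.single_le_sum (f := B) (fun _ _ => Nat.zero_le _)
        (Finset.mem_range.mpr hi)
      have h2 : b i ≤ b₀ := Finset.single_le_sum (f := b) (fun _ _ => Nat.zero_le _)
        (Finset.mem_range.mpr hi)
      have h3 : H ^ b i ≤ H ^ b₀ := pow_le_pow_right₀ hH h2
      have h4 : (B i : ℤ) ≤ B₀ := by exact_mod_cast h1
      exact mul_le_mul h4 h3 (by positivity) (by positivity)
    · rw [(degree_lt_iff_coeff_zero _ _).mp hdeg i (by omega), map_zero, abs_zero]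
      exact hM0
  have hHb : H ^ b₀ ≤ H ^ (b₀ + 1) := pow_le_pow_right₀ hH (by omega)
  have hHb' : H ≤ H ^ (b₀ + 1) := le_self_pow₀ hH (by omega)
  have hxM : 2 ^ k * k * M + M + 2 * H < x := by
    refine lt_of_le_of_lt ?_ hx
    push_cast
    have : (2 ^ k * k * B₀ + B₀ : ℤ) * H ^ b₀ ≤ (2 ^ k * k * B₀ + B₀) * H ^ (b₀ + 1) := by gcongr
    simp only [M]
    nlinarith
  have hkM : 0 ≤ 2 ^ k * k * M := by positivity
  have hPmap : P.map φ = ∏ i, (Polynomial.X - Polynomial.C (d i)) := by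
    simp only [P, Polynomial.map_prod, Polynomial.map_sub, map_X, map_C]
    refine Finset.prod_congr rfl fun i _ => ?_
    congr 2
    exact MvPolynomial.eval_X i
  have hEmap : E.map φ = Polynomial.C (2 ^ c) ^ 2 * P.map φ - Q.map φ ^ 2 := by
    simp only [hEdef, Polynomial.map_sub, Polynomial.map_mul, Polynomial.map_pow, map_pow, map_ofNat,
      Polynomial.map_ofNat]
  -- Otherwise the product would be a constant times a square of a polynomial, although its roots
  -- are simple.
  have hE0 : E.map φ ≠ 0 := by
    intro h0
    rw [hEmap, hPmap, sub_eq_zero] at h0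
    let i₀ : Fin (2 * k) := ⟨0, by omega⟩
    have hroot : (Q.map φ).IsRoot (d i₀) := by
      have := congrArg (Polynomial.eval (d i₀)) h0
      rw [eval_mul, eval_prod, Finset.prod_eq_zero (Finset.mem_univ i₀) (by simp), mul_zero,
        eval_pow] at this
      exact eq_zero_of_pow_eq_zero this.symm
    obtain ⟨R, hR⟩ := dvd_iff_isRoot.mpr hroot
    rw [← Finset.mul_prod_erase _ _ (Finset.mem_univ i₀), hR] at h0
    have h1 : Polynomial.C (2 ^ c) ^ 2 * ∏ i ∈ Finset.univ.erase i₀,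
        (Polynomial.X - Polynomial.C (d i)) = (Polynomial.X - Polynomial.C (d i₀)) * R ^ 2 := by
      apply mul_left_cancel₀ (X_sub_C_ne_zero (d i₀))
      linear_combination h0
    have h2 := congrArg (Polynomial.eval (d i₀)) h1
    rw [eval_mul, eval_mul, eval_prod] at h2
    simp only [eval_C, eval_sub, eval_X, eval_pow, sub_self, zero_mul] at h2
    rcases mul_eq_zero.mp h2 with h3 | h3
    · exact pow_ne_zero _ (pow_ne_zero _ two_ne_zero) h3
    · obtain ⟨i, hi, h4⟩ := Finset.prod_eq_zero_iff.mp h3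
      exact (Finset.mem_erase.mp hi).1 (hd (sub_eq_zero.mp h4)).symm
  -- The value of the remainder is `(2 ^ c y)² - Q(x)²`. It is nonzero because `x` exceeds every
  -- root, so as a product of two nonzero integers it is at least `|y|` in absolute value. But it is
  -- `O(x ^ (k - 1))`, whereas `|y|` has order `x ^ k`.
  obtain ⟨y, hy⟩ := hsq
  have hev : (E.map φ).eval x = (2 ^ c * y) ^ 2 - (Q.map φ).eval x ^ 2 := by
    rw [hEmap, hPmap]
    simp only [eval_sub, eval_mul, eval_C, eval_prod, eval_X, eval_pow, hy]
    ring
  have hev0 : (E.map φ).eval x ≠ 0 := fun h => by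
    have := le_of_eval_eq_zero hE0 hcoeff h
    linarith
  have hx1 : 1 ≤ x := by linarith
  have hupper : |(E.map φ).eval x| ≤ k * M * x ^ (k - 1) := by
    rw [eval_eq_sum_range' (n := k) ?_]
    · calc _ ≤ ∑ i ∈ Finset.range k, |(E.map φ).coeff i * x ^ i| := Finset.abs_sum_le_sum_abs _ _
        _ ≤ ∑ i ∈ Finset.range k, M * x ^ (k - 1) := Finset.sum_le_sum fun i hi => by
            rw [abs_mul, abs_of_nonneg (by positivity : 0 ≤ x ^ i)]
            refine mul_le_mul (hcoeff i) (pow_le_pow_right₀ hx1 ?_) (by positivity) hM0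
            have := Finset.mem_range.mp hi
            omega
        _ = _ := by rw [Finset.sum_const, Finset.card_range, nsmul_eq_mul]; ring
    · rw [natDegree_lt_iff_degree_lt hE0]
      refine lt_of_le_of_lt (degree_map_le) (lt_of_lt_of_eq hdeg ?_)
      congr 1
      omega
  have hyupper : |y| ≤ k * M * x ^ (k - 1) := by
    refine le_trans ?_ hupper
    rw [hev, sq_sub_sq, abs_mul]
    have h1 : 2 ^ c * y - (Q.map φ).eval x ≠ 0 := fun h => hev0 (by rw [hev, sq_sub_sq, h, mul_zero])
    have h2 : 2 ^ c * y + (Q.map φ).eval x ≠ 0 := fun h => hev0 (by rw [hev, sq_sub_sq, h, zero_mul])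
    have h3 := Int.one_le_abs h1
    have h4 := Int.one_le_abs h2
    have h5 : |2 * (2 ^ c * y)| ≤ |2 ^ c * y + (Q.map φ).eval x| + |2 ^ c * y - (Q.map φ).eval x| := by
      refine le_trans (le_of_eq ?_) (abs_add_le _ _)
      congr 1
      ring
    have h6 : |y| ≤ |2 ^ c * y| := by
      rw [abs_mul, abs_of_pos (by positivity : (0 : ℤ) < 2 ^ c)]
      exact le_mul_of_one_le_left (abs_nonneg _) (one_le_pow₀ (by norm_num))
    rw [abs_mul, abs_two] at h5
    nlinarith [mul_nonneg (sub_nonneg.mpr h3) (sub_nonneg.mpr h4)]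
  -- Since `x > 2H`, each factor `x - d i` is at least `x / 2`.
  have hlower : x ^ (2 * k) ≤ (2 ^ k * |y|) ^ 2 := by
    have h1 : x ^ (2 * k) ≤ ∏ i : Fin (2 * k), (2 * (x - d i)) := by
      rw [← Fin.prod_const]
      refine Finset.prod_le_prod (fun _ _ => by positivity) fun i _ => ?_
      have := (abs_le.mp (hdH i)).2
      linarith
    rw [Finset.prod_mul_distrib, hy, Fin.prod_const, mul_comm 2 k, pow_mul 2] at h1
    rwa [mul_pow, sq_abs, sq y, mul_comm 2 k]
  have hlower' : x ^ k ≤ 2 ^ k * |y| := by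
    rw [mul_comm 2 k, pow_mul] at hlower
    exact abs_le_of_sq_le_sq' hlower (by positivity) |>.2
  have hfin : x ^ (k - 1) * x ≤ x ^ (k - 1) * (2 ^ k * k * M) := by
    rw [← pow_succ, Nat.sub_add_cancel hk]
    calc _ ≤ _ := hlower'
      _ ≤ 2 ^ k * (k * M * x ^ (k - 1)) := by gcongr
      _ = _ := by ring
  have := le_of_mul_le_mul_left hfin (by positivity)
  linarith

/-- Runge's method, uniformly for all numbers of factors up to a given bound. -/
theorem exists_not_isSquare_prod_sub (K : ℕ) :
    ∃ C e : ℕ, ∀ k, 0 < k → k ≤ K → ∀ T : Finset ℕ, T.card = 2 * k → ∀ H : ℕ, 1 ≤ H →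
      (∀ d ∈ T, d ≤ H) → ∀ x : ℕ, C * H ^ e < x → ¬ IsSquare (∏ d ∈ T, ((x : ℤ) - d)) := by
  have h : ∀ k : ℕ, ∃ C e : ℕ, 0 < k → ∀ d : Fin (2 * k) → ℤ, Function.Injective d →
      ∀ H : ℤ, 1 ≤ H → (∀ i, |d i| ≤ H) → ∀ x : ℤ, C * H ^ e < x →
        ¬ IsSquare (∏ i, (x - d i)) := by
    intro k
    rcases Nat.eq_zero_or_pos k with rfl | hk
    · exact ⟨0, 0, fun h => absurd h (lt_irrefl 0)⟩
    · obtain ⟨C, e, h⟩ := not_isSquare_prod_sub hk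
      exact ⟨C, e, fun _ => h⟩
  choose C e h using h
  refine ⟨∑ k ∈ Finset.range (K + 1), C k, ∑ k ∈ Finset.range (K + 1), e k, ?_⟩
  intro k hk hkK T hT H hH hTH x hx
  have hmem : k ∈ Finset.range (K + 1) := Finset.mem_range.mpr (by omega)
  have h1 : C k ≤ _ := Finset.single_le_sum (f := C) (fun _ _ => Nat.zero_le _) hmem
  have h2 : e k ≤ _ := Finset.single_le_sum (f := e) (fun _ _ => Nat.zero_le _) hmem
  have h3 : C k * H ^ e k < x :=
    lt_of_le_of_lt (Nat.mul_le_mul h1 (Nat.pow_le_pow_right hH h2)) hx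
  let f := T.equivFinOfCardEq hT
  have key := h k hk (fun i => ((f.symm i : ℕ) : ℤ))
    (fun i j hij => f.symm.injective (Subtype.ext (Nat.cast_injective hij))) H
    (by exact_mod_cast hH)
    (fun i => by
      rw [abs_of_nonneg (by positivity)]
      exact_mod_cast hTH _ (f.symm i).2) x (by exact_mod_cast h3)
  rwa [Equiv.prod_comp f.symm (fun t : T => ((x : ℤ) - (t : ℕ))),
    Finset.prod_coe_sort T (fun d : ℕ => ((x : ℤ) - d))] at key

/-! ### Squared distances between lattice points on a circle -/

/-- The squared length of an integer vector. -/
def sqNorm (v : Fin 2 → ℤ) : ℕ := (v 0 ^ 2 + v 1 ^ 2).natAbs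

theorem sqNorm_cast (v : Fin 2 → ℤ) : (sqNorm v : ℤ) = v 0 ^ 2 + v 1 ^ 2 := by
  rw [sqNorm, Int.natCast_natAbs, abs_of_nonneg (by positivity)]

theorem mem_latticePoints_sqNorm (v : Fin 2 → ℤ) : v ∈ latticePoints (sqNorm v) := by
  rw [mem_latticePoints, sqNorm_cast]

theorem sqNorm_pos {v : Fin 2 → ℤ} (hv : v ≠ 0) : 0 < sqNorm v := by
  by_contra h
  have h0 : v 0 ^ 2 + v 1 ^ 2 = 0 := by
    rw [← sqNorm_cast]
    exact_mod_cast Nat.le_zero.mp (not_lt.mp h)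
  apply hv
  ext i
  fin_cases i
  · exact eq_zero_of_pow_eq_zero (by nlinarith [sq_nonneg (v 0), sq_nonneg (v 1)] : v 0 ^ 2 = 0)
  · exact eq_zero_of_pow_eq_zero (by nlinarith [sq_nonneg (v 0), sq_nonneg (v 1)] : v 1 ^ 2 = 0)

theorem norm_toPlane (v : Fin 2 → ℤ) : ‖toPlane v‖ = √(sqNorm v : ℝ) := by
  rw [EuclideanSpace.norm_eq]
  congr 1
  have := sqNorm_cast v
  have h : (sqNorm v : ℝ) = (v 0 : ℝ) ^ 2 + (v 1 : ℝ) ^ 2 := by exact_mod_cast this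
  rw [h, Fin.sum_univ_two]
  simp [toPlane]

/-- The conditions satisfied by the squared distance `d` of two points of norm `m`. -/
structure IsSqDist (m d : ℕ) : Prop where
  pos : 0 < d
  sum_sq : ∃ x y : ℕ, d = x ^ 2 + y ^ 2
  isSquare : IsSquare ((d : ℤ) * ((4 * m : ℕ) - d))

/-- The vectors `μ - ν` and `μ + ν` are orthogonal, with squared lengths `d` and `4m - d`. The
product of these is therefore the square of their determinant, `2 det(μ, ν)`. -/
theorem isSqDist_sqNorm_sub {m : ℕ} {μ ν : Fin 2 → ℤ} (hμ : μ ∈ latticePoints m)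
    (hν : ν ∈ latticePoints m) (hne : μ ≠ ν) : IsSqDist m (sqNorm (μ - ν)) := by
  refine ⟨sqNorm_pos (sub_ne_zero.mpr hne), ⟨(μ 0 - ν 0).natAbs, (μ 1 - ν 1).natAbs, ?_⟩, ?_⟩
  · zify
    rw [sqNorm_cast]
    simp
  · rw [mem_latticePoints] at hμ hν
    refine ⟨2 * (μ 0 * ν 1 - μ 1 * ν 0), ?_⟩
    rw [sqNorm_cast]
    push_cast
    simp only [Pi.sub_apply]
    have h : (4 * m : ℤ) = 2 * (μ 0 ^ 2 + μ 1 ^ 2) + 2 * (ν 0 ^ 2 + ν 1 ^ 2) := by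
      rw [hμ, hν]
      ring
    rw [h]
    have h' : μ 0 ^ 2 + μ 1 ^ 2 = ν 0 ^ 2 + ν 1 ^ 2 := hμ.trans hν.symm
    linear_combination (μ 0 ^ 2 + μ 1 ^ 2 - ν 0 ^ 2 - ν 1 ^ 2) * h'

/-- The primes that may divide the squarefree part of a squared distance. -/
def splitPrimes (m : ℕ) : Finset ℕ := insert 2 (m.primeFactors.filter fun p => p % 4 = 1)

theorem two_pow_card_splitPrimes_le {m : ℕ} (hm : m ≠ 0) (hne : (latticePoints m).Nonempty) :
    2 ^ (splitPrimes m).card ≤ 2 * numPoints m := by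
  rw [← card_normPoints]
  calc _ ≤ 2 ^ ((m.primeFactors.filter fun p => p % 4 = 1).card + 1) :=
        Nat.pow_le_pow_right two_pos (Finset.card_insert_le _ _)
    _ = 2 * 2 ^ (m.primeFactors.filter fun p => p % 4 = 1).card := by ring
    _ ≤ _ := Nat.mul_le_mul_left _
        (two_pow_card_filter_le_card_normPoints hm (hne.image _))

/-- A prime of the squarefree part has odd exponent in `d`. It is not `3` modulo `4` since `d` is a
sum of two squares. As `d(4m - d)` is a square, it also divides `4m - d`, hence `4m`. -/
theorem IsSqDist.mem_splitPrimes {m d a b p : ℕ} (h : IsSqDist m d) (hm : m ≠ 0)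
    (hd : b ^ 2 * a = d) (ha : Squarefree a) (hp : p.Prime) (hpa : p ∣ a) :
    p ∈ splitPrimes m := by
  have := Fact.mk hp
  have hd0 : d ≠ 0 := h.pos.ne'
  have hb0 : b ≠ 0 := by rintro rfl; simp at hd; omega
  have ha0 : a ≠ 0 := by rintro rfl; simp at hd; omega
  have hpd : p ∣ d := hd ▸ hpa.mul_left _
  have h3 : p % 4 ≠ 3 := by
    intro h3
    have hev := Nat.eq_sq_add_sq_iff.mp h.sum_sq p (Nat.mem_primeFactors.mpr ⟨hp, hpd, hd0⟩) h3
    rw [← hd, padicValNat.mul (pow_ne_zero 2 hb0) ha0, padicValNat.pow] at hev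
    have h1 : padicValNat p a = 1 := by
      have h2 := ha.natFactorization_le_one p
      rw [Nat.factorization_def _ hp] at h2
      have := one_le_padicValNat_of_dvd ha0 hpa
      omega
    rw [h1] at hev
    exact Nat.not_even_iff_odd.mpr (odd_two_mul_add_one _) hev
  have hpZ : Prime (p : ℤ) := Nat.prime_iff_prime_int.mp hp
  have hdvd : (p : ℤ) ∣ ((4 * m : ℕ) : ℤ) - d := by
    obtain ⟨A, hA⟩ := h.isSquare
    obtain ⟨a', rfl⟩ := hpa
    have hbZ : (b : ℤ) ≠ 0 := by exact_mod_cast hb0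
    have hpZ0 : (p : ℤ) ≠ 0 := hpZ.ne_zero
    obtain ⟨A', rfl⟩ : (b : ℤ) ∣ A := by
      rw [← Int.pow_dvd_pow_iff two_ne_zero, sq A, ← hA, ← hd]
      push_cast
      exact ⟨p * a' * (4 * m - b ^ 2 * (p * a')), by ring⟩
    have h1 : (p : ℤ) * a' * (((4 * m : ℕ) : ℤ) - d) = A' * A' := by
      apply mul_left_cancel₀ (pow_ne_zero 2 hbZ)
      have hd' : (d : ℤ) = b ^ 2 * (p * a') := by rw [← hd]; push_cast; ring
      rw [hd'] at hA ⊢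
      linear_combination hA
    obtain ⟨A'', rfl⟩ : (p : ℤ) ∣ A' :=
      (hpZ.dvd_or_dvd (⟨_, by rw [← h1, mul_assoc]⟩ : (p : ℤ) ∣ A' * A')).elim id id
    have h2 : (a' : ℤ) * (((4 * m : ℕ) : ℤ) - d) = p * (A'' * A'') := by
      apply mul_left_cancel₀ hpZ0
      linear_combination h1
    rcases hpZ.dvd_or_dvd (⟨_, h2⟩ : (p : ℤ) ∣ a' * _) with h4 | h4
    · exfalso
      have h5 : p * p ∣ p * a' := Nat.mul_dvd_mul_left p (Int.natCast_dvd_natCast.mp h4)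
      exact hp.one_lt.ne' (Nat.isUnit_iff.mp (ha p h5))
    · exact h4
  have h4m : p ∣ 4 * m := by
    have := dvd_add hdvd (Int.natCast_dvd_natCast.mpr hpd)
    rw [sub_add_cancel] at this
    exact Int.natCast_dvd_natCast.mp this
  rw [splitPrimes, Finset.mem_insert, Finset.mem_filter, Nat.mem_primeFactors]
  rcases hp.eq_two_or_odd with h2 | h2
  · exact Or.inl h2
  · refine Or.inr ⟨⟨hp, ?_, hm⟩, by omega⟩
    rcases hp.dvd_mul.mp h4m with h4 | h4
    · have h5 : p ∣ 2 := hp.dvd_of_dvd_pow (by simpa using h4 : p ∣ 2 ^ 2)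
      have := (Nat.prime_dvd_prime_iff_eq hp Nat.prime_two).mp h5
      omega
    · exact h4

theorem exists_prod_eq_sq_mul {m : ℕ} (hm : m ≠ 0) {S : Finset ℕ} (hS : ∀ d ∈ S, IsSqDist m d) :
    ∃ w ⊆ splitPrimes m, ∃ c : ℕ, ∏ d ∈ S, d = c ^ 2 * ∏ p ∈ w, p := by
  have h : ∀ d : ℕ, ∃ a b : ℕ, b ^ 2 * a = d ∧ Squarefree a := Nat.sq_mul_squarefree
  choose a b hd ha using h
  obtain ⟨a', b', hd', ha'⟩ := Nat.sq_mul_squarefree (∏ d ∈ S, a d)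
  refine ⟨a'.primeFactors, fun p hp => ?_, (∏ d ∈ S, b d) * b', ?_⟩
  · have hpp := Nat.prime_of_mem_primeFactors hp
    have hpd : p ∣ ∏ d ∈ S, a d := hd' ▸ (Nat.dvd_of_mem_primeFactors hp).mul_left _
    obtain ⟨d, hdS, hpad⟩ := (Prime.dvd_finsetProd_iff hpp.prime _).mp hpd
    exact (hS d hdS).mem_splitPrimes hm (hd d) (ha d) hpp hpad
  · rw [Nat.prod_primeFactors_of_squarefree ha', mul_pow, mul_assoc, hd', ← Finset.prod_pow,
      ← Finset.prod_mul_distrib]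
    exact Finset.prod_congr rfl fun d _ => (hd d).symm

/-- If there are many squared distances, then some even number of them multiply to a square. -/
theorem exists_isSquare_prod {m k : ℕ} (hm : m ≠ 0) {D : Finset ℕ} (hD : ∀ d ∈ D, IsSqDist m d)
    (hlt : 2 ^ (splitPrimes m).card < D.card.choose k) :
    ∃ T ⊆ D, ∃ j, 0 < j ∧ j ≤ k ∧ T.card = 2 * j ∧ IsSquare (∏ d ∈ T, d) := by
  have h : ∀ S : Finset ℕ, ∃ w ⊆ splitPrimes m, ∃ c : ℕ, S ⊆ D →
      ∏ d ∈ S, d = c ^ 2 * ∏ p ∈ w, p := by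
    intro S
    by_cases hS : S ⊆ D
    · obtain ⟨w, hw, c, hc⟩ := exists_prod_eq_sq_mul hm fun d hd => hD d (hS hd)
      exact ⟨w, hw, c, fun _ => hc⟩
    · exact ⟨∅, Finset.empty_subset _, 0, fun h => absurd h hS⟩
  choose w hw c hc using h
  -- Pigeonhole on square classes. Both subsets have size `k`, so their symmetric difference has
  -- even size, and the common part enters the product of the two products as a square.
  obtain ⟨S₁, hS₁, S₂, hS₂, hne, heq⟩ := Finset.exists_ne_map_eq_of_card_lt_of_maps_to
    (s := D.powersetCard k) (t := (splitPrimes m).powerset) (f := w)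
    (by rwa [Finset.card_powersetCard, Finset.card_powerset])
    (fun S _ => Finset.mem_powerset.mpr (hw S))
  rw [Finset.mem_powersetCard] at hS₁ hS₂
  have hcard : (S₁ \ S₂).card = (S₂ \ S₁).card :=
    Finset.card_sdiff_comm (hS₁.2.trans hS₂.2.symm)
  have hdisj : Disjoint (S₁ \ S₂) (S₂ \ S₁) := disjoint_sdiff_sdiff
  refine ⟨S₁ \ S₂ ∪ S₂ \ S₁, Finset.union_subset (Finset.sdiff_subset.trans hS₁.1)
    (Finset.sdiff_subset.trans hS₂.1), (S₁ \ S₂).card, ?_, ?_, ?_, ?_⟩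
  · rw [Finset.card_pos, Finset.sdiff_nonempty]
    exact fun hsub => hne (Finset.eq_of_subset_of_card_le hsub (hS₂.2.trans hS₁.2.symm).le)
  · exact hS₁.2 ▸ Finset.card_le_card Finset.sdiff_subset
  · rw [Finset.card_union_of_disjoint hdisj, ← hcard, two_mul]
  · rw [Finset.prod_union hdisj]
    set y := ∏ d ∈ S₁ ∩ S₂, d
    have hy : y ≠ 0 := Finset.prod_ne_zero_iff.mpr fun d hd =>
      (hD d (hS₁.1 (Finset.mem_inter.mp hd).1)).pos.ne'
    have h₁ : (∏ d ∈ S₁ \ S₂, d) * y = ∏ d ∈ S₁, d := by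
      rw [← Finset.sdiff_inter_self_left S₁ S₂]
      exact Finset.prod_sdiff Finset.inter_subset_left
    have h₂ : (∏ d ∈ S₂ \ S₁, d) * y = ∏ d ∈ S₂, d := by
      rw [← Finset.sdiff_inter_self_left S₂ S₁, Finset.inter_comm S₂ S₁]
      exact Finset.prod_sdiff Finset.inter_subset_right
    set z := c S₁ * c S₂ * ∏ p ∈ w S₁, p
    have hz : ((∏ d ∈ S₁ \ S₂, d) * ∏ d ∈ S₂ \ S₁, d) * y ^ 2 = z ^ 2 := by
      calc _ = ((∏ d ∈ S₁ \ S₂, d) * y) * ((∏ d ∈ S₂ \ S₁, d) * y) := by ring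
        _ = _ := by
          rw [h₁, h₂, hc S₁ hS₁.1, hc S₂ hS₂.1, ← heq]
          ring
    obtain ⟨x, hx⟩ : y ∣ z := (Nat.pow_dvd_pow_iff two_ne_zero).mp (Dvd.intro_left _ hz)
    refine ⟨x, Nat.eq_of_mul_eq_mul_right (pow_pos (Nat.pos_of_ne_zero hy) 2) ?_⟩
    rw [hz, hx]
    ring

/-- The product of the squares `d(4m - d)` is a square; divide it by the nonzero square `∏ d`. -/
theorem isSquare_prod_sub {m : ℕ} {T : Finset ℕ} (hT : ∀ d ∈ T, IsSqDist m d)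
    (hsq : IsSquare (∏ d ∈ T, d)) : IsSquare (∏ d ∈ T, (((4 * m : ℕ) : ℤ) - d)) := by
  obtain ⟨y, hy⟩ := hsq
  have h : ∀ d : ℕ, ∃ A : ℤ, d ∈ T → (d : ℤ) * ((4 * m : ℕ) - d) = A * A := by
    intro d
    by_cases hd : d ∈ T
    · obtain ⟨A, hA⟩ := (hT d hd).isSquare
      exact ⟨A, fun _ => hA⟩
    · exact ⟨0, fun h => absurd h hd⟩
  choose A hA using h
  have hy0 : y ≠ 0 := by
    rintro rfl
    exact Finset.prod_ne_zero_iff.mpr (fun d hd => (hT d hd).pos.ne') hy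
  have hz : (y : ℤ) ^ 2 * ∏ d ∈ T, (((4 * m : ℕ) : ℤ) - d) = (∏ d ∈ T, A d) ^ 2 := by
    have : ((y : ℤ)) ^ 2 = ∏ d ∈ T, (d : ℤ) := by
      rw [sq]
      rw [← Nat.cast_prod, hy, Nat.cast_mul]
    rw [this, ← Finset.prod_mul_distrib, sq, ← Finset.prod_mul_distrib]
    exact Finset.prod_congr rfl hA
  obtain ⟨x, hx⟩ : (y : ℤ) ∣ ∏ d ∈ T, A d :=
    (Int.pow_dvd_pow_iff two_ne_zero).mp (Dvd.intro _ hz)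
  refine ⟨x, mul_left_cancel₀ (pow_ne_zero 2 (by exact_mod_cast hy0 : (y : ℤ) ≠ 0)) ?_⟩
  rw [hz, hx]
  ring

/-- There are few small squared distances between the points of norm `m`. -/
theorem exists_choose_card_le (k : ℕ) :
    ∃ C e : ℕ, ∀ m : ℕ, m ≠ 0 → (latticePoints m).Nonempty → ∀ D : Finset ℕ,
      (∀ d ∈ D, IsSqDist m d ∧ C * d ^ e < 4 * m) → D.card.choose k ≤ 2 * numPoints m := by
  obtain ⟨C, e, h⟩ := exists_not_isSquare_prod_sub k
  refine ⟨C, e, fun m hm hne D hD => ?_⟩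
  refine le_trans ?_ (two_pow_card_splitPrimes_le hm hne)
  by_contra! hlt
  obtain ⟨T, hTD, j, hj, hjk, hcard, hsq⟩ := exists_isSquare_prod hm (fun d hd => (hD d hd).1) hlt
  have hTne : T.Nonempty := by
    rw [← Finset.card_pos]
    omega
  -- `H` is the largest element of `T`, so the smallness assumption on that single distance is the
  -- threshold in Runge's method at `x = 4m`.
  obtain ⟨H, hHT, hH⟩ := Finset.exists_mem_eq_sup T hTne id
  exact h j hj hjk T hcard H (hD H (hTD hHT)).1.pos (fun d hd => (Finset.le_sup (f := id) hd).trans hH.le)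
    (4 * m) (hD H (hTD hHT)).2 (isSquare_prod_sub (fun d hd => (hD d (hTD hd)).1) hsq)

/-- Both `μ` and `μ - v` lie on the circle, which fixes `⟨v, μ⟩ = |v|²/2` and hence `det(v, μ)` up
to sign. The second solution is the reflected pair `(-ν, -μ)`. -/
theorem card_filter_sub_eq_le_two {m : ℕ} {v : Fin 2 → ℤ} (hv : v ≠ 0) :
    ((latticePoints m ×ˢ latticePoints m).filter fun q => q.1 - q.2 = v).card ≤ 2 := by
  rcases ((latticePoints m ×ˢ latticePoints m).filter fun q => q.1 - q.2 = v).eq_empty_or_nonempty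
    with he | ⟨⟨μ, ν⟩, hq⟩
  · simp [he]
  have hd : v 0 ^ 2 + v 1 ^ 2 ≠ 0 := by
    rw [← sqNorm_cast]
    exact_mod_cast (sqNorm_pos hv).ne'
  simp only [Finset.mem_filter, Finset.mem_product, mem_latticePoints] at hq
  obtain ⟨⟨hμ, hν⟩, rfl⟩ := hq
  refine (Finset.card_le_card (t := {(μ, ν), (-ν, -μ)}) ?_).trans Finset.card_le_two
  rintro ⟨μ', ν'⟩ hq'
  simp only [Finset.mem_filter, Finset.mem_product, mem_latticePoints] at hq'
  obtain ⟨⟨hμ', hν'⟩, hv'⟩ := hq'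
  have e0 : μ' 0 - ν' 0 = μ 0 - ν 0 := congrFun hv' 0
  have e1 : μ' 1 - ν' 1 = μ 1 - ν 1 := congrFun hv' 1
  simp only [Pi.sub_apply] at hd
  set a := μ 0 - ν 0
  set b := μ 1 - ν 1
  have f0 : ν' 0 = μ' 0 - a := by linarith
  have f1 : ν' 1 = μ' 1 - b := by linarith
  have g0 : ν 0 = μ 0 - a := by simp [a]
  have g1 : ν 1 = μ 1 - b := by simp [b]
  rw [f0, f1] at hν'
  rw [g0, g1] at hν
  have hin : 2 * (a * μ' 0 + b * μ' 1) = a ^ 2 + b ^ 2 := by linarith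
  have hin' : 2 * (a * μ 0 + b * μ 1) = a ^ 2 + b ^ 2 := by linarith
  have hin2 : a * μ' 0 + b * μ' 1 = a * μ 0 + b * μ 1 := by linarith
  have hs : (a * μ' 1 - b * μ' 0 - (a * μ 1 - b * μ 0)) *
      (a * μ' 1 - b * μ' 0 + (a * μ 1 - b * μ 0)) = 0 := by
    linear_combination (a ^ 2 + b ^ 2) * hμ' - (a ^ 2 + b ^ 2) * hμ -
      (a * μ' 0 + b * μ' 1 + (a * μ 0 + b * μ 1)) * hin2
  have hext : ∀ x y : Fin 2 → ℤ, x 0 = y 0 → x 1 = y 1 → x = y := by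
    intro x y h0 h1
    ext i
    fin_cases i
    · exact h0
    · exact h1
  rw [Finset.mem_insert, Finset.mem_singleton, Prod.mk.injEq, Prod.mk.injEq]
  rcases mul_eq_zero.mp hs with h | h
  · left
    have h0 : μ' 0 = μ 0 := by
      apply mul_left_cancel₀ hd
      linear_combination a * hin2 - b * h
    have h1 : μ' 1 = μ 1 := by
      apply mul_left_cancel₀ hd
      linear_combination b * hin2 + a * h
    exact ⟨hext _ _ h0 h1, hext _ _ (by rw [f0, g0, h0]) (by rw [f1, g1, h1])⟩
  · right
    have h0 : μ' 0 = a - μ 0 := by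
      apply mul_left_cancel₀ hd
      linear_combination a * hin2 + a * hin' - b * h
    have h1 : μ' 1 = b - μ 1 := by
      apply mul_left_cancel₀ hd
      linear_combination b * hin2 + b * hin' + a * h
    exact ⟨hext _ _ (by simp [h0, a]) (by simp [h1, b]),
      hext _ _ (by simp [f0, h0]) (by simp [f1, h1])⟩

theorem card_filter_sqNorm_eq_le {m d : ℕ} (hd : 0 < d) :
    ((latticePoints m ×ˢ latticePoints m).filter fun q => sqNorm (q.1 - q.2) = d).card ≤
      2 * numPoints d := by
  refine Finset.card_le_mul_card_image_of_maps_to (f := fun q => q.1 - q.2) (fun q hq => ?_) 2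
    fun v hv => ?_
  · have := (Finset.mem_filter.mp hq).2
    exact this ▸ mem_latticePoints_sqNorm _
  · have hv0 : v ≠ 0 := by
      rintro rfl
      rw [mem_latticePoints] at hv
      simp at hv
      omega
    refine (Finset.card_le_card ?_).trans (card_filter_sub_eq_le_two (m := m) hv0)
    intro q hq
    simp only [Finset.mem_filter] at hq ⊢
    exact ⟨hq.1.1, hq.2⟩

/-- For `J ≥ k` use `(J + 1 - k) ^ k ≤ k! * choose J k` and take `k`-th roots. -/
theorem card_le_of_choose_le {J k N : ℕ} (hk : 0 < k) (hN : 1 ≤ N) (h : J.choose k ≤ 2 * N)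
    {ε : ℝ} (hε : 1 / (k : ℝ) ≤ ε) : (J : ℝ) ≤ 3 * k * (N : ℝ) ^ ε := by
  have hN' : (1 : ℝ) ≤ N := by exact_mod_cast hN
  have hk' : (1 : ℝ) ≤ k := by exact_mod_cast hk
  have hN1 : (1 : ℝ) ≤ (N : ℝ) ^ ε := Real.one_le_rpow hN' (le_trans (by positivity) hε)
  rcases lt_or_ge J k with hJ | hJ
  · have : (J : ℝ) ≤ k := by exact_mod_cast hJ.le
    nlinarith
  have h1 : (J + 1 - k) ^ k ≤ k ^ k * (2 * N) := by
    calc _ ≤ J.descFactorial k := Nat.pow_sub_le_descFactorial J k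
      _ = k.factorial * J.choose k := Nat.descFactorial_eq_factorial_mul_choose J k
      _ ≤ k ^ k * (2 * N) := Nat.mul_le_mul (Nat.factorial_le_pow k) h
  have h2 : (J : ℝ) - k ≤ k * (2 * N) ^ (1 / (k : ℝ)) := by
    have h3 : ((J : ℝ) - k) ^ k ≤ (k * (2 * N) ^ (1 / (k : ℝ))) ^ k := by
      rw [mul_pow, ← Real.rpow_mul_natCast (by positivity), one_div_mul_cancel (by positivity),
        Real.rpow_one]
      have h4 : ((J + 1 - k : ℕ) : ℝ) ^ k ≤ k ^ k * (2 * N) := by exact_mod_cast h1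
      refine le_trans (pow_le_pow_left₀ ?_ ?_ k) h4
      · rw [sub_nonneg]; exact_mod_cast hJ
      · rw [Nat.cast_sub (by omega)]
        push_cast
        linarith
    exact le_of_pow_le_pow_left₀ hk.ne' (by positivity) h3
  have h5 : ((2 : ℝ) * N) ^ (1 / (k : ℝ)) ≤ 2 * (N : ℝ) ^ ε := by
    rw [Real.mul_rpow (by norm_num) (by positivity)]
    refine mul_le_mul ?_ (Real.rpow_le_rpow_of_exponent_le hN' hε) (by positivity) (by norm_num)
    calc (2 : ℝ) ^ (1 / (k : ℝ)) ≤ 2 ^ (1 : ℝ) :=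
          Real.rpow_le_rpow_of_exponent_le one_le_two (by rw [div_le_one (by positivity)]; exact hk')
      _ = 2 := Real.rpow_one 2
  nlinarith

/-- The sum of the reciprocals of the distances between lattice points of norm `m`. -/
theorem exists_sum_inv_norm_sub_le {ε : ℝ} (hε : 0 < ε) :
    ∃ K : ℝ, 0 ≤ K ∧ ∀ m : ℕ, m ≠ 0 → (latticePoints m).Nonempty →
      ∑ q ∈ (latticePoints m).offDiag, ‖toPlane (q.1 - q.2)‖⁻¹ ≤
        K * (numPoints m : ℝ) ^ ε := by
  obtain ⟨k, hk⟩ := exists_nat_ge (1 / ε)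
  have hk0 : 0 < k := by
    have : (0 : ℝ) < k := lt_of_lt_of_le (by positivity) hk
    exact_mod_cast this
  have hkε : 1 / (k : ℝ) ≤ ε := by
    rw [div_le_iff₀ (by positivity)]
    rw [div_le_iff₀ hε] at hk
    linarith
  obtain ⟨C, e, hchoose⟩ := exists_choose_card_le k
  obtain ⟨C₁, hC₁, hhalf⟩ := exists_numPoints_le_rpow (δ := 1 / 2) (by norm_num)
  -- The exponent is such that `m ≤ C d ^ (e + 1)` gives `N² ≪ m ^ (2δ) ≪ √d`, so that a pair at
  -- large distance contributes `O(N⁻²)`.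
  obtain ⟨C₂, hC₂, hsmall⟩ := exists_numPoints_le_rpow (δ := 1 / (4 * (e + 1 : ℝ))) (by positivity)
  set δ : ℝ := 1 / (4 * (e + 1 : ℝ)) with hδ
  refine ⟨2 * C₁ * (3 * k) + C₂ ^ 2 * (C : ℝ) ^ (2 * δ), by positivity, fun m hm hne => ?_⟩
  set N := numPoints m with hNdef
  have hN : 1 ≤ N := Finset.card_pos.mpr hne
  have hN1 : (1 : ℝ) ≤ N := by exact_mod_cast hN
  have hN' : (1 : ℝ) ≤ (N : ℝ) ^ ε := Real.one_le_rpow hN1 hε.le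
  rw [← Finset.sum_filter_add_sum_filter_not _ (fun q => C * sqNorm (q.1 - q.2) ^ e < 4 * m), add_mul]
  refine add_le_add ?_ ?_
  · set S := (latticePoints m).offDiag.filter fun q => C * sqNorm (q.1 - q.2) ^ e < 4 * m with hS
    set D := S.image fun q => sqNorm (q.1 - q.2)
    have hD : ∀ d ∈ D, IsSqDist m d ∧ C * d ^ e < 4 * m := by
      intro d hd
      obtain ⟨q, hq, rfl⟩ := Finset.mem_image.mp hd
      rw [hS, Finset.mem_filter, Finset.mem_offDiag] at hq
      exact ⟨isSqDist_sqNorm_sub hq.1.1 hq.1.2.1 hq.1.2.2, hq.2⟩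
    have hJ := card_le_of_choose_le hk0 hN (hchoose m hm hne D hD) hkε
    rw [← Finset.sum_fiberwise_of_maps_to (s := S) (t := D)
      (g := fun q => sqNorm (q.1 - q.2)) (fun q hq => Finset.mem_image_of_mem _ hq)]
    -- A fixed squared distance `d` occurs for at most `2 N_d ≤ 2 C₁ √d` pairs, each of weight
    -- `1/√d`.
    calc _ ≤ ∑ d ∈ D, 2 * C₁ := Finset.sum_le_sum fun d hd => ?_
      _ = 2 * C₁ * (D.card : ℝ) := by rw [Finset.sum_const, nsmul_eq_mul, mul_comm]
      _ ≤ 2 * C₁ * (3 * k * (N : ℝ) ^ ε) := by gcongr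
      _ = _ := by ring
    have hd0 := (hD d hd).1.pos
    have hsqrt : 0 < √(d : ℝ) := Real.sqrt_pos.mpr (by exact_mod_cast hd0)
    calc _ = ∑ q ∈ S.filter fun q => sqNorm (q.1 - q.2) = d, (√(d : ℝ))⁻¹ :=
          Finset.sum_congr rfl fun q hq => by rw [norm_toPlane, (Finset.mem_filter.mp hq).2]
      _ = ((S.filter fun q => sqNorm (q.1 - q.2) = d).card : ℝ) * (√(d : ℝ))⁻¹ := by
          rw [Finset.sum_const, nsmul_eq_mul]
      _ ≤ (2 * numPoints d : ℝ) * (√(d : ℝ))⁻¹ := by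
          gcongr
          have : (S.filter fun q => sqNorm (q.1 - q.2) = d).card ≤ 2 * numPoints d := by
            refine (Finset.card_le_card ?_).trans (card_filter_sqNorm_eq_le (m := m) hd0)
            intro q hq
            simp only [hS, Finset.mem_filter, Finset.mem_offDiag, Finset.mem_product] at hq ⊢
            exact ⟨⟨hq.1.1.1, hq.1.1.2.1⟩, hq.2⟩
          exact_mod_cast this
      _ ≤ (2 * (C₁ * √(d : ℝ))) * (√(d : ℝ))⁻¹ := by
          gcongr
          rw [Real.sqrt_eq_rpow]
          exact hhalf d hd0.ne'
      _ = 2 * C₁ := by field_simp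
  · set S := (latticePoints m).offDiag.filter fun q => ¬ C * sqNorm (q.1 - q.2) ^ e < 4 * m with hS
    have hterm : ∀ q ∈ S, ‖toPlane (q.1 - q.2)‖⁻¹ ≤ C₂ ^ 2 * (C : ℝ) ^ (2 * δ) / (N : ℝ) ^ 2 := by
      intro q hq
      rw [hS, Finset.mem_filter, Finset.mem_offDiag, not_lt] at hq
      set d := sqNorm (q.1 - q.2) with hd
      have hd0 : 0 < d := sqNorm_pos (sub_ne_zero.mpr hq.1.2.2)
      have hd1 : (1 : ℝ) ≤ d := by exact_mod_cast hd0
      have hsqrt : 0 < √(d : ℝ) := Real.sqrt_pos.mpr (by exact_mod_cast hd0)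
      have hmd : (m : ℝ) ≤ C * (d : ℝ) ^ (e + 1) := by
        have h1 : m ≤ C * d ^ (e + 1) := by
          calc m ≤ 4 * m := by omega
            _ ≤ C * d ^ e := hq.2
            _ ≤ _ := Nat.mul_le_mul_left _ (Nat.pow_le_pow_right hd0 (by omega))
        exact_mod_cast h1
      rw [norm_toPlane, ← hd, le_div_iff₀ (by positivity), inv_mul_le_iff₀ hsqrt]
      calc (N : ℝ) ^ 2 ≤ (C₂ * (m : ℝ) ^ δ) ^ 2 := by
            gcongr
            exact hsmall m hm
        _ = C₂ ^ 2 * (m : ℝ) ^ (2 * δ) := by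
            rw [mul_pow, ← Real.rpow_mul_natCast (by positivity)]
            congr 2
            push_cast
            ring
        _ ≤ C₂ ^ 2 * (C * (d : ℝ) ^ (e + 1)) ^ (2 * δ) := by gcongr
        _ = √(d : ℝ) * (C₂ ^ 2 * (C : ℝ) ^ (2 * δ)) := by
            rw [Real.mul_rpow (by positivity) (by positivity), ← Real.rpow_natCast_mul (by positivity),
              Real.sqrt_eq_rpow]
            have : ((e + 1 : ℕ) : ℝ) * (2 * δ) = 1 / 2 := by
              rw [hδ]
              push_cast
              field_simp
              norm_num
            rw [this]
            ring
    calc _ ≤ ∑ q ∈ S, C₂ ^ 2 * (C : ℝ) ^ (2 * δ) / (N : ℝ) ^ 2 := Finset.sum_le_sum hterm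
      _ = (S.card : ℝ) * (C₂ ^ 2 * (C : ℝ) ^ (2 * δ) / (N : ℝ) ^ 2) := by
          rw [Finset.sum_const, nsmul_eq_mul]
      _ ≤ (N : ℝ) ^ 2 * (C₂ ^ 2 * (C : ℝ) ^ (2 * δ) / (N : ℝ) ^ 2) := by
          gcongr
          have : S.card ≤ N ^ 2 := by
            refine (Finset.card_filter_le _ _).trans ?_
            rw [Finset.offDiag_card, hNdef, numPoints, sq]
            exact Nat.sub_le _ _
          exact_mod_cast this
      _ = C₂ ^ 2 * (C : ℝ) ^ (2 * δ) := by field_simp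
      _ ≤ _ := le_mul_of_one_le_right (by positivity) hN'

/-! ### Oscillatory integrals with nondegenerate phase -/

theorem norm_integral_zero_le {E : Type*} [NormedAddCommGroup E] [NormedSpace ℝ E] {L B : ℝ}
    (hL : 0 ≤ L) {f : ℝ → E} (hf : ∀ t ∈ Set.Icc 0 L, ‖f t‖ ≤ B) :
    ‖∫ t in (0 : ℝ)..L, f t‖ ≤ B * L := by
  have h := intervalIntegral.norm_integral_le_of_norm_le_const (a := 0) (b := L) (C := B) (f := f)
    fun t ht => hf t (Set.Ioc_subset_Icc_self (by rwa [Set.uIoc_of_le hL] at ht))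
  rwa [sub_zero, abs_of_nonneg hL] at h

/-- A function that is transversal to `0` spends little time near `0`. -/
theorem integral_inv_sq_add_sq_le {L B c δ : ℝ} {u u' u'' : ℝ → ℝ} (hL : 0 ≤ L) (hB : 0 ≤ B)
    (hc : 0 < c) (hδ : 0 < δ) (hδ1 : δ ≤ 1) (hu : ContinuousOn u (Set.Icc 0 L))
    (hu' : ContinuousOn u' (Set.Icc 0 L)) (hu'' : ContinuousOn u'' (Set.Icc 0 L))
    (hd : ∀ t ∈ Set.Ioo 0 L, HasDerivAt u (u' t) t)
    (hd' : ∀ t ∈ Set.Ioo 0 L, HasDerivAt u' (u'' t) t)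
    (hb' : ∀ t ∈ Set.Icc 0 L, |u' t| ≤ B) (hb'' : ∀ t ∈ Set.Icc 0 L, |u'' t| ≤ B)
    (htrans : ∀ t ∈ Set.Icc 0 L, c ≤ u t ^ 2 + u' t ^ 2) :
    ∫ t in (0 : ℝ)..L, (u t ^ 2 + δ ^ 2)⁻¹ ≤ (B * Real.pi * (1 + L) + L) / c / δ := by
  have hpos : ∀ t, 0 < u t ^ 2 + δ ^ 2 := fun t => by positivity
  have hq : ContinuousOn (fun t => (u t ^ 2 + δ ^ 2)⁻¹) (Set.Icc 0 L) :=
    ((hu.pow 2).add continuousOn_const).inv₀ fun t _ => (hpos t).ne'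
  have harc : ContinuousOn (fun t => Real.arctan (u t / δ)) (Set.Icc 0 L) :=
    Real.continuous_arctan.comp_continuousOn (hu.div_const δ)
  have hint : ∀ {f : ℝ → ℝ}, ContinuousOn f (Set.Icc 0 L) → IntervalIntegrable f volume 0 L :=
    fun hf => hf.intervalIntegrable_of_Icc hL
  have harcb : ∀ x, |Real.arctan x| ≤ Real.pi / 2 := fun x =>
    abs_le.mpr ⟨(Real.neg_pi_div_two_lt_arctan x).le, (Real.arctan_lt_pi_div_two x).le⟩
  have h1 : IntervalIntegrable (fun t => u'' t * Real.arctan (u t / δ)) volume 0 L :=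
    hint (hu''.mul harc)
  have h2 : IntervalIntegrable (fun t => u' t ^ 2 * δ * (u t ^ 2 + δ ^ 2)⁻¹) volume 0 L :=
    hint (((hu'.pow 2).mul continuousOn_const).mul hq)
  have h3 : IntervalIntegrable (fun t => c * δ * (u t ^ 2 + δ ^ 2)⁻¹) volume 0 L :=
    hint (continuousOn_const.mul hq)
  -- The fundamental theorem for `u' arctan(u/δ)`, which is bounded independently of `δ`; its
  -- derivative contains `δ u'² / (u² + δ²)`.
  have hparts : (∫ t in (0 : ℝ)..L, u'' t * Real.arctan (u t / δ)) +
      (∫ t in (0 : ℝ)..L, u' t ^ 2 * δ * (u t ^ 2 + δ ^ 2)⁻¹) =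
      u' L * Real.arctan (u L / δ) - u' 0 * Real.arctan (u 0 / δ) := by
    rw [← intervalIntegral.integral_add h1 h2]
    refine intervalIntegral.integral_eq_sub_of_hasDerivAt_of_le hL
      (f := fun t => u' t * Real.arctan (u t / δ)) (hu'.mul harc) (fun t ht => ?_) (h1.add h2)
    convert! (hd' t ht).mul ((hd t ht).div_const δ).arctan using 1
    have := (hpos t).ne'
    field_simp
    ring
  have hbd1 : |∫ t in (0 : ℝ)..L, u'' t * Real.arctan (u t / δ)| ≤ B * (Real.pi / 2) * L := by
    rw [← Real.norm_eq_abs]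
    refine norm_integral_zero_le hL fun t ht => ?_
    rw [Real.norm_eq_abs, abs_mul]
    exact mul_le_mul (hb'' t ht) (harcb _) (abs_nonneg _) hB
  have hbd : ∀ t ∈ Set.Icc 0 L, |u' t * Real.arctan (u t / δ)| ≤ B * (Real.pi / 2) := by
    intro t ht
    rw [abs_mul]
    exact mul_le_mul (hb' t ht) (harcb _) (abs_nonneg _) hB
  have h0 := abs_le.mp (hbd 0 ⟨le_rfl, hL⟩)
  have hL' := abs_le.mp (hbd L ⟨hL, le_rfl⟩)
  have hbd1' := abs_le.mp hbd1
  have hpi := Real.pi_pos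
  have hBL : 0 ≤ B * Real.pi * L := by positivity
  -- Pointwise, `c δ ≤ δ u'² + δ u²`, and `δ u² ≤ u² + δ²` because `δ ≤ 1`.
  have hmain : c * δ * ∫ t in (0 : ℝ)..L, (u t ^ 2 + δ ^ 2)⁻¹ ≤
      (∫ t in (0 : ℝ)..L, u' t ^ 2 * δ * (u t ^ 2 + δ ^ 2)⁻¹) + L := by
    rw [← intervalIntegral.integral_const_mul]
    have h4 : (∫ t in (0 : ℝ)..L, (1 : ℝ)) = L := by simp
    conv_rhs => rhs; rw [← h4]
    rw [← intervalIntegral.integral_add h2 intervalIntegrable_const]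
    refine intervalIntegral.integral_mono_on hL h3 (h2.add intervalIntegrable_const) fun t ht => ?_
    rw [← div_eq_mul_inv, ← div_eq_mul_inv, div_add_one (hpos t).ne']
    refine div_le_div_of_nonneg_right ?_ (hpos t).le
    nlinarith [htrans t ht, sq_nonneg (u t), sq_nonneg δ, mul_le_mul_of_nonneg_right hδ1 (sq_nonneg (u t)),
      mul_le_mul_of_nonneg_right (htrans t ht) hδ.le]
  rw [div_div, le_div_iff₀ (by positivity), mul_comm]
  linarith

/-- Van der Corput's estimate with an amplitude, for phases whose first two derivatives do not
vanish simultaneously. -/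
theorem norm_integral_mul_cexp_le {L B M c l : ℝ} {u u' u'' φ A A' : ℝ → ℝ} (hL : 0 ≤ L)
    (hB : 0 ≤ B) (hM : 0 ≤ M) (hc : 0 < c) (hl : 1 ≤ l)
    (hu : ContinuousOn u (Set.Icc 0 L)) (hu' : ContinuousOn u' (Set.Icc 0 L))
    (hu'' : ContinuousOn u'' (Set.Icc 0 L)) (hφ : ContinuousOn φ (Set.Icc 0 L))
    (hA : ContinuousOn A (Set.Icc 0 L)) (hA' : ContinuousOn A' (Set.Icc 0 L))
    (hd : ∀ t ∈ Set.Ioo 0 L, HasDerivAt u (u' t) t)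
    (hd' : ∀ t ∈ Set.Ioo 0 L, HasDerivAt u' (u'' t) t)
    (hdφ : ∀ t ∈ Set.Ioo 0 L, HasDerivAt φ (l * u t) t)
    (hdA : ∀ t ∈ Set.Ioo 0 L, HasDerivAt A (A' t) t)
    (hb' : ∀ t ∈ Set.Icc 0 L, |u' t| ≤ B) (hb'' : ∀ t ∈ Set.Icc 0 L, |u'' t| ≤ B)
    (htrans : ∀ t ∈ Set.Icc 0 L, c ≤ u t ^ 2 + u' t ^ 2)
    (hbA : ∀ t ∈ Set.Icc 0 L, |A t| ≤ 1) (hbA' : ∀ t ∈ Set.Icc 0 L, |A' t| ≤ M) :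
    ‖∫ t in (0 : ℝ)..L, (A t : ℂ) * Complex.exp (φ t * Complex.I)‖ ≤
      (1 + M * L + (B + 1) * ((B * Real.pi * (1 + L) + L) / c)) / √l := by
  have hl0 : 0 < l := by linarith
  have hsl : 1 ≤ √l := Real.one_le_sqrt.mpr hl
  have hsl0 : 0 < √l := by linarith
  -- Integration by parts would use `1/u`, singular at stationary points. It is replaced by `w =
  -- u/(u² + δ²)`, for which `w u = 1 - δ² q`. With `l δ² = 1` the correction is `O(q)`, and both
  -- `sup |w|` and `∫ q` are `O(√l)`, so dividing by `l` leaves the decay `1/√l`.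
  set δ : ℝ := (√l)⁻¹ with hδdef
  have hδ : 0 < δ := inv_pos.mpr hsl0
  have hδ1 : δ ≤ 1 := inv_le_one_of_one_le₀ hsl
  have hlδ : l * δ ^ 2 = 1 := by
    rw [hδdef, inv_pow, Real.sq_sqrt hl0.le, mul_inv_cancel₀ hl0.ne']
  set J := (B * Real.pi * (1 + L) + L) / c
  have hJ := integral_inv_sq_add_sq_le hL hB hc hδ hδ1 hu hu' hu'' hd hd' hb' hb'' htrans
  have hpos : ∀ t, 0 < u t ^ 2 + δ ^ 2 := fun t => by positivity
  have hq : ContinuousOn (fun t => (u t ^ 2 + δ ^ 2)⁻¹) (Set.Icc 0 L) :=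
    ((hu.pow 2).add continuousOn_const).inv₀ fun t _ => (hpos t).ne'
  set q : ℝ → ℝ := fun t => (u t ^ 2 + δ ^ 2)⁻¹ with hqdef
  have hq0 : ∀ t, 0 < q t := fun t => inv_pos.mpr (hpos t)
  set w : ℝ → ℝ := fun t => u t * q t with hwdef
  set w' : ℝ → ℝ := fun t => u' t * (δ ^ 2 - u t ^ 2) * q t ^ 2 with hw'def
  have hwc : ContinuousOn w (Set.Icc 0 L) := hu.mul hq
  have hw'c : ContinuousOn w' (Set.Icc 0 L) :=
    (hu'.mul (continuousOn_const.sub (hu.pow 2))).mul (hq.pow 2)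
  have hdw : ∀ t ∈ Set.Ioo 0 L, HasDerivAt w (w' t) t := by
    intro t ht
    have h := (hd t ht).mul ((((hd t ht).pow 2).add_const (δ ^ 2)).inv (hpos t).ne')
    convert! h using 1
    simp only [hw'def, hqdef, Nat.cast_ofNat]
    have := (hpos t).ne'
    simp only [Pi.pow_apply, Pi.inv_apply]
    field_simp
    ring
  have hwb : ∀ t, |w t| ≤ δ⁻¹ / 2 := by
    intro t
    simp only [hwdef, hqdef]
    rw [← div_eq_mul_inv, abs_div, abs_of_pos (hpos t), div_le_iff₀ (hpos t)]
    have h1 : δ⁻¹ / 2 * (u t ^ 2 + δ ^ 2) = (u t ^ 2 + δ ^ 2) / (2 * δ) := by field_simp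
    rw [h1, le_div_iff₀ (by positivity), ← sq_abs (u t)]
    nlinarith [sq_nonneg (|u t| - δ)]
  have hw'b : ∀ t ∈ Set.Icc 0 L, |w' t| ≤ B * q t := by
    intro t ht
    simp only [hw'def]
    rw [abs_mul, abs_mul, abs_of_nonneg (sq_nonneg (q t)), mul_assoc]
    refine mul_le_mul (hb' t ht) ?_ (by positivity) hB
    have h1 : |δ ^ 2 - u t ^ 2| ≤ u t ^ 2 + δ ^ 2 :=
      abs_le.mpr ⟨by nlinarith [sq_nonneg (u t), sq_nonneg δ], by nlinarith [sq_nonneg (u t)]⟩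
    calc _ ≤ (u t ^ 2 + δ ^ 2) * q t ^ 2 := by gcongr
      _ = q t := by
        simp only [hqdef]
        have := (hpos t).ne'
        field_simp
  set e : ℝ → ℂ := fun t => Complex.exp (φ t * Complex.I) with hedef
  have hec : ContinuousOn e (Set.Icc 0 L) :=
    Complex.continuous_exp.comp_continuousOn
      ((Complex.continuous_ofReal.comp_continuousOn hφ).mul continuousOn_const)
  have hen : ∀ t, ‖e t‖ = 1 := fun t => Complex.norm_exp_ofReal_mul_I (φ t)
  have hcast : ∀ {f : ℝ → ℝ}, ContinuousOn f (Set.Icc 0 L) →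
      ContinuousOn (fun t => (f t : ℂ)) (Set.Icc 0 L) :=
    fun hf => Complex.continuous_ofReal.comp_continuousOn hf
  set R : ℝ → ℂ := fun t =>
    ((A' t * w t + A t * w' t : ℝ) - Complex.I * (l * (A t * δ ^ 2 * q t) : ℝ)) * e t with hRdef
  have hRc : ContinuousOn R (Set.Icc 0 L) :=
    ((hcast ((hA'.mul hwc).add (hA.mul hw'c))).sub (continuousOn_const.mul
      (hcast (continuousOn_const.mul ((hA.mul continuousOn_const).mul hq))))).mul hec
  have hAe : ContinuousOn (fun t => (A t : ℂ) * e t) (Set.Icc 0 L) := (hcast hA).mul hec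
  have hi1 : IntervalIntegrable (fun t => Complex.I * l * ((A t : ℂ) * e t)) volume 0 L :=
    (continuousOn_const.mul hAe).intervalIntegrable_of_Icc hL
  have hi2 : IntervalIntegrable R volume 0 L := hRc.intervalIntegrable_of_Icc hL
  set F : ℝ → ℂ := fun t => ((A t * w t : ℝ) : ℂ) * e t with hFdef
  have hFc : ContinuousOn F (Set.Icc 0 L) := (hcast (hA.mul hwc)).mul hec
  -- Up to the remainder `R`, the function `A w e` is a primitive of `i l` times the integrand.
  have hFd : ∀ t ∈ Set.Ioo 0 L, HasDerivAt F (Complex.I * l * ((A t : ℂ) * e t) + R t) t := by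
    intro t ht
    have h1 : HasDerivAt e (e t * ((l * u t : ℝ) * Complex.I)) t :=
      ((hdφ t ht).ofReal_comp.mul_const Complex.I).cexp
    have h2 := (((hdA t ht).mul (hdw t ht)).ofReal_comp).mul h1
    convert! h2 using 1
    simp only [hRdef, Pi.mul_apply]
    have h3 : ((w t * u t : ℝ) : ℂ) = 1 - (δ ^ 2 * q t : ℝ) := by
      have : w t * u t = 1 - δ ^ 2 * q t := by
        simp only [hwdef, hqdef]
        have := (hpos t).ne'
        field_simp
        ring
      rw [this]
      push_cast
      ring
    push_cast at h3 ⊢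
    linear_combination (-(Complex.I * l * A t * e t)) * h3
  have hftc := intervalIntegral.integral_eq_sub_of_hasDerivAt_of_le hL hFc hFd (hi1.add hi2)
  rw [intervalIntegral.integral_add hi1 hi2, intervalIntegral.integral_const_mul] at hftc
  have hFb : ∀ t ∈ Set.Icc 0 L, ‖F t‖ ≤ δ⁻¹ / 2 := by
    intro t ht
    simp only [hFdef]
    rw [norm_mul, hen, mul_one, Complex.norm_real, Real.norm_eq_abs, abs_mul]
    calc _ ≤ 1 * (δ⁻¹ / 2) := mul_le_mul (hbA t ht) (hwb t) (abs_nonneg _) zero_le_one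
      _ = _ := one_mul _
  have hRb : ∀ t ∈ Set.Icc 0 L, ‖R t‖ ≤ M * δ⁻¹ + (B + 1) * q t := by
    intro t ht
    simp only [hRdef]
    rw [norm_mul, hen, mul_one]
    refine (norm_sub_le _ _).trans ?_
    rw [norm_mul, Complex.norm_I, one_mul, Complex.norm_real, Complex.norm_real, Real.norm_eq_abs,
      Real.norm_eq_abs]
    have h1 : |A' t * w t| ≤ M * δ⁻¹ := by
      rw [abs_mul]
      refine mul_le_mul (hbA' t ht) ((hwb t).trans ?_) (abs_nonneg _) hM
      have := inv_pos.mpr hδ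
      linarith
    have h2 : |A t * w' t| ≤ B * q t := by
      rw [abs_mul]
      calc _ ≤ 1 * (B * q t) := mul_le_mul (hbA t ht) (hw'b t ht) (abs_nonneg _) zero_le_one
        _ = _ := one_mul _
    have h3 : |l * (A t * δ ^ 2 * q t)| ≤ q t := by
      have : l * (A t * δ ^ 2 * q t) = A t * q t := by linear_combination (A t * q t) * hlδ
      rw [this, abs_mul, abs_of_pos (hq0 t)]
      calc _ ≤ 1 * q t := mul_le_mul_of_nonneg_right (hbA t ht) (hq0 t).le
        _ = _ := one_mul _
    linarith [abs_add_le (A' t * w t) (A t * w' t)]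
  have hqi : IntervalIntegrable q volume 0 L := hq.intervalIntegrable_of_Icc hL
  have hRi : ‖∫ t in (0 : ℝ)..L, R t‖ ≤ M * δ⁻¹ * L + (B + 1) * (J / δ) := by
    calc _ ≤ ∫ t in (0 : ℝ)..L, ‖R t‖ := intervalIntegral.norm_integral_le_integral_norm hL
      _ ≤ ∫ t in (0 : ℝ)..L, (M * δ⁻¹ + (B + 1) * q t) :=
          intervalIntegral.integral_mono_on hL hi2.norm (by
            exact (intervalIntegrable_const).add (hqi.const_mul _)) hRb
      _ = M * δ⁻¹ * L + (B + 1) * ∫ t in (0 : ℝ)..L, q t := by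
          rw [intervalIntegral.integral_add intervalIntegrable_const (hqi.const_mul _),
            intervalIntegral.integral_const, intervalIntegral.integral_const_mul, smul_eq_mul]
          ring
      _ ≤ _ := by gcongr
  have hnorm : l * ‖∫ t in (0 : ℝ)..L, (A t : ℂ) * e t‖ ≤
      δ⁻¹ * (1 + M * L + (B + 1) * J) := by
    have h1 : Complex.I * l * ∫ t in (0 : ℝ)..L, (A t : ℂ) * e t =
        F L - F 0 - ∫ t in (0 : ℝ)..L, R t := by rw [← hftc]; ring
    have h2 := congrArg norm h1
    rw [norm_mul, norm_mul, Complex.norm_I, one_mul, Complex.norm_real, Real.norm_eq_abs,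
      abs_of_pos hl0] at h2
    rw [h2]
    have h3 := norm_sub_le (F L - F 0) (∫ t in (0 : ℝ)..L, R t)
    have h4 := norm_sub_le (F L) (F 0)
    have h5 := hFb L ⟨hL, le_rfl⟩
    have h6 := hFb 0 ⟨le_rfl, hL⟩
    have h7 : δ⁻¹ * (1 + M * L + (B + 1) * J) =
        δ⁻¹ + (M * δ⁻¹ * L + (B + 1) * (J / δ)) := by rw [div_eq_mul_inv]; ring
    rw [h7]
    linarith
  rw [hδdef, inv_inv] at hnorm
  rw [le_div_iff₀ hsl0]
  refine le_of_mul_le_mul_left ?_ hsl0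
  calc _ = (√l * √l) * ‖∫ t in (0 : ℝ)..L, (A t : ℂ) * e t‖ := by ring
    _ = l * ‖∫ t in (0 : ℝ)..L, (A t : ℂ) * e t‖ := by rw [Real.mul_self_sqrt hl0.le]
    _ ≤ _ := hnorm

/-- Pythagoras in the orthogonal frame `e, g`, scaled by `‖g‖²` so that `g = 0` is allowed. In the
plane `g` is `s` times the rotation of `e` by a right angle. -/
theorem inner_sq_mul_norm_sq_add {e g : EuclideanSpace ℝ (Fin 2)} (he : ‖e‖ = 1)
    (hg : inner ℝ e g = 0) (v : EuclideanSpace ℝ (Fin 2)) :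
    (inner ℝ v e) ^ 2 * ‖g‖ ^ 2 + (inner ℝ v g) ^ 2 = ‖v‖ ^ 2 * ‖g‖ ^ 2 := by
  have he' : ‖e‖ ^ 2 = 1 := by rw [he, one_pow]
  simp only [EuclideanSpace.real_norm_sq_eq, PiLp.inner_apply, Fin.sum_univ_two,
    RCLike.inner_apply, conj_trivial] at *
  obtain ⟨s, h0, h1⟩ : ∃ s : ℝ, g 0 = -s * e 1 ∧ g 1 = s * e 0 :=
    ⟨e 0 * g 1 - e 1 * g 0, by linear_combination (-(g 0)) * he' + e 0 * hg,
      by linear_combination (-(g 1)) * he' + e 1 * hg⟩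
  rw [h0, h1]
  linear_combination s ^ 2 * (v 0 * e 0 + v 1 * e 1) ^ 2 * he'

/-- A real amplitude on `[0, L]`, bounded by `1` and with derivative bounded by `M`. -/
def IsAmplitude (L M : ℝ) (A : ℝ → ℝ) : Prop :=
  ContinuousOn A (Set.Icc 0 L) ∧ (∀ t ∈ Set.Icc 0 L, |A t| ≤ 1) ∧
    ∃ A' : ℝ → ℝ, ContinuousOn A' (Set.Icc 0 L) ∧
      (∀ t ∈ Set.Ioo 0 L, HasDerivAt A (A' t) t) ∧ ∀ t ∈ Set.Icc 0 L, |A' t| ≤ M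

theorem isAmplitude_one {L M : ℝ} (hM : 0 ≤ M) : IsAmplitude L M fun _ => 1 :=
  ⟨continuousOn_const, fun _ _ => by simp, fun _ => 0, continuousOn_const,
    fun t _ => hasDerivAt_const t 1, fun _ _ => by simpa using hM⟩

theorem IsAmplitude.mul {L M : ℝ} {A₁ A₂ : ℝ → ℝ} (h₁ : IsAmplitude L M A₁)
    (h₂ : IsAmplitude L M A₂) : IsAmplitude L (2 * M) fun t => A₁ t * A₂ t := by
  obtain ⟨c₁, b₁, A₁', c₁', d₁, b₁'⟩ := h₁
  obtain ⟨c₂, b₂, A₂', c₂', d₂, b₂'⟩ := h₂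
  refine ⟨c₁.mul c₂, fun t ht => ?_, fun t => A₁' t * A₂ t + A₁ t * A₂' t,
    (c₁'.mul c₂).add (c₁.mul c₂'), fun t ht => (d₁ t ht).mul (d₂ t ht), fun t ht => ?_⟩
  · rw [abs_mul]
    exact mul_le_one₀ (b₁ t ht) (abs_nonneg _) (b₂ t ht)
  · have hM : 0 ≤ M := (abs_nonneg _).trans (b₁' t ht)
    refine (abs_add_le _ _).trans ?_
    rw [abs_mul, abs_mul]
    have e₁ := mul_le_mul (b₁' t ht) (b₂ t ht) (abs_nonneg _) hM
    have e₂ := mul_le_mul (b₁ t ht) (b₂' t ht) (abs_nonneg _) zero_le_one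
    linarith

/-! ### Geometry of the curve and decay of its oscillatory integrals -/

namespace SmoothCurve

variable (c : SmoothCurve)

theorem uniqueDiffOn : UniqueDiffOn ℝ (Set.Icc 0 c.length) := uniqueDiffOn_Icc c.length_pos

/-- The acceleration `γ̈`. -/
def acceleration (t : ℝ) : EuclideanSpace ℝ (Fin 2) :=
  derivWithin c.velocity (Set.Icc 0 c.length) t

/-- The third derivative of `γ`. -/
def jerk (t : ℝ) : EuclideanSpace ℝ (Fin 2) :=
  derivWithin c.acceleration (Set.Icc 0 c.length) t

theorem contDiffOn_velocity : ContDiffOn ℝ ∞ c.velocity (Set.Icc 0 c.length) :=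
  c.smooth.derivWithin c.uniqueDiffOn (by simp)

theorem contDiffOn_acceleration : ContDiffOn ℝ ∞ c.acceleration (Set.Icc 0 c.length) :=
  c.contDiffOn_velocity.derivWithin c.uniqueDiffOn (by simp)

theorem contDiffOn_jerk : ContDiffOn ℝ ∞ c.jerk (Set.Icc 0 c.length) :=
  c.contDiffOn_acceleration.derivWithin c.uniqueDiffOn (by simp)

theorem hasDerivWithinAt_lift {t : ℝ} (ht : t ∈ Set.Icc 0 c.length) :
    HasDerivWithinAt c.lift (c.velocity t) (Set.Icc 0 c.length) t :=
  (c.smooth.differentiableOn (by simp) t ht).hasDerivWithinAt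

theorem hasDerivWithinAt_velocity {t : ℝ} (ht : t ∈ Set.Icc 0 c.length) :
    HasDerivWithinAt c.velocity (c.acceleration t) (Set.Icc 0 c.length) t :=
  (c.contDiffOn_velocity.differentiableOn (by simp) t ht).hasDerivWithinAt

theorem hasDerivWithinAt_acceleration {t : ℝ} (ht : t ∈ Set.Icc 0 c.length) :
    HasDerivWithinAt c.acceleration (c.jerk t) (Set.Icc 0 c.length) t :=
  (c.contDiffOn_acceleration.differentiableOn (by simp) t ht).hasDerivWithinAt

theorem norm_velocity {t : ℝ} (ht : t ∈ Set.Icc 0 c.length) : ‖c.velocity t‖ = 1 :=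
  c.unit_speed t ht

theorem inner_velocity_acceleration {t : ℝ} (ht : t ∈ Set.Icc 0 c.length) :
    inner ℝ (c.velocity t) (c.acceleration t) = 0 := by
  have h1 := (c.hasDerivWithinAt_velocity ht).inner ℝ (c.hasDerivWithinAt_velocity ht)
  have h2 : HasDerivWithinAt (fun s => inner ℝ (c.velocity s) (c.velocity s)) 0
      (Set.Icc 0 c.length) t := by
    refine (hasDerivWithinAt_const t (Set.Icc 0 c.length) (1 : ℝ)).congr (fun s hs => ?_) ?_
    · rw [real_inner_self_eq_norm_sq, c.norm_velocity hs, one_pow]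
    · rw [real_inner_self_eq_norm_sq, c.norm_velocity ht, one_pow]
  have h3 := (c.uniqueDiffOn t ht).eq_deriv _ h1 h2
  have h4 := real_inner_comm (c.velocity t) (c.acceleration t)
  linarith

theorem exists_bound_derivatives :
    ∃ B : ℝ, 0 ≤ B ∧ ∀ t ∈ Set.Icc 0 c.length, ‖c.acceleration t‖ ≤ B ∧ ‖c.jerk t‖ ≤ B := by
  obtain ⟨B₁, h₁⟩ := isCompact_Icc.exists_bound_of_continuousOn c.contDiffOn_acceleration.continuousOn
  obtain ⟨B₂, h₂⟩ := isCompact_Icc.exists_bound_of_continuousOn c.contDiffOn_jerk.continuousOn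
  have h0 : (0 : ℝ) ∈ Set.Icc 0 c.length := ⟨le_rfl, c.length_pos.le⟩
  exact ⟨max B₁ B₂, le_max_of_le_left ((norm_nonneg _).trans (h₁ 0 h0)), fun t ht =>
    ⟨(h₁ t ht).trans (le_max_left _ _), (h₂ t ht).trans (le_max_right _ _)⟩⟩

theorem exists_le_curvature (hcurv : ∀ t ∈ Set.Icc 0 c.length, c.curvature t ≠ 0) :
    ∃ κ : ℝ, 0 < κ ∧ ∀ t ∈ Set.Icc 0 c.length, κ ≤ ‖c.acceleration t‖ := by
  obtain ⟨t₀, ht₀, hmin⟩ := isCompact_Icc.exists_isMinOn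
    (Set.nonempty_Icc.mpr c.length_pos.le) c.contDiffOn_acceleration.continuousOn.norm
  exact ⟨‖c.acceleration t₀‖, lt_of_le_of_ne (norm_nonneg _) (hcurv t₀ ht₀).symm,
    fun t ht => hmin ht⟩

theorem hasDerivAt_of_within {E : Type*} [NormedAddCommGroup E] [NormedSpace ℝ E] {f : ℝ → E}
    {f' : E} {t : ℝ} (ht : t ∈ Set.Ioo 0 c.length)
    (h : HasDerivWithinAt f f' (Set.Icc 0 c.length) t) : HasDerivAt f f' t :=
  h.hasDerivAt (Icc_mem_nhds ht.1 ht.2)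

theorem hasDerivAt_inner {f : ℝ → EuclideanSpace ℝ (Fin 2)} {f' : EuclideanSpace ℝ (Fin 2)}
    {t : ℝ} (v : EuclideanSpace ℝ (Fin 2)) (ht : t ∈ Set.Ioo 0 c.length)
    (h : HasDerivWithinAt f f' (Set.Icc 0 c.length) t) :
    HasDerivAt (fun s => inner ℝ v (f s)) (inner ℝ v f') t :=
  (innerSL ℝ v).hasFDerivAt.comp_hasDerivAt t (c.hasDerivAt_of_within ht h)

theorem exists_isAmplitude_inner_velocity :
    ∃ M : ℝ, 0 ≤ M ∧ ∀ n : EuclideanSpace ℝ (Fin 2), ‖n‖ ≤ 1 →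
      IsAmplitude c.length M fun t => inner ℝ n (c.velocity t) := by
  obtain ⟨B, hB, h⟩ := c.exists_bound_derivatives
  refine ⟨B, hB, fun n hn => ⟨ContinuousOn.inner (𝕜 := ℝ) continuousOn_const c.contDiffOn_velocity.continuousOn,
    fun t ht => ?_, fun t => inner ℝ n (c.acceleration t),
    ContinuousOn.inner (𝕜 := ℝ) continuousOn_const c.contDiffOn_acceleration.continuousOn,
    fun t ht => c.hasDerivAt_inner n ht
      (c.hasDerivWithinAt_velocity (Set.Ioo_subset_Icc_self ht)), fun t ht => ?_⟩⟩
  · refine (abs_real_inner_le_norm _ _).trans ?_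
    rwa [c.norm_velocity ht, mul_one]
  · refine (abs_real_inner_le_norm _ _).trans ?_
    calc _ ≤ 1 * B := mul_le_mul hn (h t ht).1 (norm_nonneg _) zero_le_one
      _ = B := one_mul B

/-- The exponential `e^{2πi⟨v, γ(t)⟩}`. -/
def expi (v : EuclideanSpace ℝ (Fin 2)) (t : ℝ) : ℂ :=
  Complex.exp ((2 * Real.pi * inner ℝ v (c.lift t) : ℝ) * Complex.I)

/-- The oscillatory integral `∫ A(t) e^{2πi⟨v, γ(t)⟩} dt`. -/
def osc (v : EuclideanSpace ℝ (Fin 2)) (A : ℝ → ℝ) : ℂ :=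
  ∫ t in (0 : ℝ)..c.length, (A t : ℂ) * c.expi v t

theorem continuousOn_expi (v : EuclideanSpace ℝ (Fin 2)) :
    ContinuousOn (c.expi v) (Set.Icc 0 c.length) :=
  Complex.continuous_exp.comp_continuousOn ((Complex.continuous_ofReal.comp_continuousOn
    (continuousOn_const.mul (ContinuousOn.inner (𝕜 := ℝ) continuousOn_const c.smooth.continuousOn))).mul
      continuousOn_const)

/-- With `n = v/‖v‖`, the phase has derivative `2π‖v‖⟨n, γ̇⟩`. As `γ̈ ⟂ γ̇`, the numbers `⟨n, γ̇⟩`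
and `⟨n, γ̈⟩` cannot both be small when the curvature is bounded below. All constants are uniform in
the direction `n`. -/
theorem exists_norm_osc_le (hcurv : ∀ t ∈ Set.Icc 0 c.length, c.curvature t ≠ 0) {M : ℝ}
    (hM : 0 ≤ M) :
    ∃ C : ℝ, 0 ≤ C ∧ ∀ v : EuclideanSpace ℝ (Fin 2), 1 ≤ ‖v‖ → ∀ A, IsAmplitude c.length M A →
      ‖c.osc v A‖ ≤ C / √‖v‖ := by
  obtain ⟨B, hB, hbd⟩ := c.exists_bound_derivatives
  obtain ⟨κ, hκ, hlow⟩ := c.exists_le_curvature hcurv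
  have hL := c.length_pos.le
  -- With `a = ⟨n, γ̇⟩²`, the transversality quantity equals `a + (1 - a)|γ̈|²`, a convex
  -- combination of `1` and a number at least `κ²`.
  set c₀ : ℝ := min 1 (κ ^ 2)
  have hc₀ : 0 < c₀ := lt_min one_pos (by positivity)
  refine ⟨1 + M * c.length + (B + 1) * ((B * Real.pi * (1 + c.length) + c.length) / c₀),
    by positivity, fun v hv A ⟨hA, hAb, A', hA', hdA, hAb'⟩ => ?_⟩
  have hv0 : 0 < ‖v‖ := by linarith
  set n : EuclideanSpace ℝ (Fin 2) := ‖v‖⁻¹ • v with hn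
  have hn1 : ‖n‖ = 1 := by
    rw [hn, norm_smul, norm_inv, norm_norm, inv_mul_cancel₀ hv0.ne']
  have hvn : ∀ x, inner ℝ v x = ‖v‖ * inner ℝ n x := by
    intro x
    rw [hn, real_inner_smul_left, ← mul_assoc, mul_inv_cancel₀ hv0.ne', one_mul]
  have hpi := Real.pi_gt_three
  have hl : ‖v‖ ≤ 2 * Real.pi * ‖v‖ := by nlinarith
  have hbn : ∀ x : EuclideanSpace ℝ (Fin 2), ‖x‖ ≤ B → |inner ℝ n x| ≤ B := by
    intro x hx
    refine (abs_real_inner_le_norm _ _).trans ?_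
    rwa [hn1, one_mul]
  have key := norm_integral_mul_cexp_le (l := 2 * Real.pi * ‖v‖) (c := c₀)
    (u := fun t => inner ℝ n (c.velocity t)) (u' := fun t => inner ℝ n (c.acceleration t))
    (u'' := fun t => inner ℝ n (c.jerk t)) (φ := fun t => 2 * Real.pi * inner ℝ v (c.lift t))
    hL hB hM hc₀ (by linarith)
    (ContinuousOn.inner (𝕜 := ℝ) continuousOn_const c.contDiffOn_velocity.continuousOn)
    (ContinuousOn.inner (𝕜 := ℝ) continuousOn_const c.contDiffOn_acceleration.continuousOn)
    (ContinuousOn.inner (𝕜 := ℝ) continuousOn_const c.contDiffOn_jerk.continuousOn)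
    (continuousOn_const.mul (ContinuousOn.inner (𝕜 := ℝ) continuousOn_const c.smooth.continuousOn)) hA hA'
    (fun t ht => c.hasDerivAt_inner n ht (c.hasDerivWithinAt_velocity (Set.Ioo_subset_Icc_self ht)))
    (fun t ht => c.hasDerivAt_inner n ht
      (c.hasDerivWithinAt_acceleration (Set.Ioo_subset_Icc_self ht)))
    (fun t ht => by
      convert! (c.hasDerivAt_inner v ht
        (c.hasDerivWithinAt_lift (Set.Ioo_subset_Icc_self ht))).const_mul (2 * Real.pi) using 1
      rw [hvn]
      ring)
    hdA (fun t ht => hbn _ (hbd t ht).1) (fun t ht => hbn _ (hbd t ht).2)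
    (fun t ht => by
      have h1 := inner_sq_mul_norm_sq_add (c.norm_velocity ht) (c.inner_velocity_acceleration ht) n
      rw [hn1, one_pow, one_mul] at h1
      have h2 := hlow t ht
      have h3 : κ ^ 2 ≤ ‖c.acceleration t‖ ^ 2 := pow_le_pow_left₀ hκ.le h2 2
      set a := (inner ℝ n (c.velocity t) : ℝ) ^ 2
      have ha0 : 0 ≤ a := sq_nonneg _
      have ha : a ≤ 1 := by
        have h4 := abs_real_inner_le_norm n (c.velocity t)
        rw [hn1, c.norm_velocity ht, one_mul] at h4
        exact (sq_le_one_iff_abs_le_one _).mpr h4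
      have h5 : c₀ ≤ 1 := min_le_left _ _
      have h6 : c₀ ≤ κ ^ 2 := min_le_right _ _
      have h7 : (1 - a) * c₀ ≤ (1 - a) * ‖c.acceleration t‖ ^ 2 :=
        mul_le_mul_of_nonneg_left (h6.trans h3) (by linarith)
      nlinarith) hAb hAb'
  refine key.trans (div_le_div_of_nonneg_left (by positivity) (Real.sqrt_pos.mpr hv0)
    (Real.sqrt_le_sqrt hl))

end SmoothCurve

/-! ### Second moments of the Gaussian coefficients and the covariance -/

section Moments

theorem integrable_ofReal_gaussian : Integrable (fun x : ℝ => (x : ℂ)) (gaussianReal 0 (1 / 2)) :=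
  ((memLp_id_gaussianReal 1).integrable le_rfl).ofReal

theorem integral_ofReal_gaussian : ∫ x : ℝ, (x : ℂ) ∂gaussianReal 0 (1 / 2) = 0 := by
  rw [integral_complex_ofReal, integral_id_gaussianReal, Complex.ofReal_zero]

theorem integrable_sq_gaussian : Integrable (fun x : ℝ => x ^ 2) (gaussianReal 0 (1 / 2)) :=
  (memLp_id_gaussianReal 2).integrable_sq

theorem integral_sq_gaussian : ∫ x : ℝ, x ^ 2 ∂gaussianReal 0 (1 / 2) = 1 / 2 := by
  have h := variance_of_integral_eq_zero (μ := gaussianReal 0 (1 / 2)) (X := id) aemeasurable_id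
    integral_id_gaussianReal
  rw [variance_id_gaussianReal] at h
  simpa using h.symm

theorem integrable_ofReal_sq_gaussian :
    Integrable (fun x : ℝ => (x : ℂ) ^ 2) (gaussianReal 0 (1 / 2)) := by
  simpa using integrable_sq_gaussian.ofReal (𝕜 := ℂ)

theorem integral_ofReal_sq_gaussian :
    ∫ x : ℝ, (x : ℂ) ^ 2 ∂gaussianReal 0 (1 / 2) = 1 / 2 := by
  have h := integral_complex_ofReal (μ := gaussianReal 0 (1 / 2)) (f := fun x : ℝ => x ^ 2)
  rw [integral_sq_gaussian] at h
  simpa using h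

theorem measurableEquivRealProd_symm_eq (p : ℝ × ℝ) :
    Complex.measurableEquivRealProd.symm p = p.1 + p.2 * Complex.I := by
  apply Complex.ext <;> simp [Complex.measurableEquivRealProd]

theorem integral_stdComplexGaussian : ∫ z, z ∂stdComplexGaussian = 0 := by
  rw [stdComplexGaussian, integral_map_equiv]
  simp only [measurableEquivRealProd_symm_eq]
  have h := integrable_ofReal_gaussian
  rw [integral_add (h.comp_fst _) ((h.comp_snd _).mul_const _), integral_mul_const,
    integral_fun_fst, integral_fun_snd, integral_ofReal_gaussian]
  simp

/-- The real and imaginary parts are uncorrelated with equal variances. This disposes of the pairs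
`ν = -μ`, whose coefficients are dependent. -/
theorem integral_sq_stdComplexGaussian : ∫ z, z ^ 2 ∂stdComplexGaussian = 0 := by
  rw [stdComplexGaussian, integral_map_equiv]
  simp only [measurableEquivRealProd_symm_eq]
  have h := integrable_ofReal_gaussian
  have h2 := integrable_ofReal_sq_gaussian
  have hexp : ∀ p : ℝ × ℝ, ((p.1 : ℂ) + p.2 * Complex.I) ^ 2 =
      ((p.1 : ℂ) ^ 2 - (p.2 : ℂ) ^ 2) + (p.1 : ℂ) * p.2 * (2 * Complex.I) := by
    intro p
    linear_combination (p.2 : ℂ) ^ 2 * Complex.I_sq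
  simp only [hexp]
  have hi : Integrable (fun p : ℝ × ℝ => (p.1 : ℂ) ^ 2 - (p.2 : ℂ) ^ 2)
      ((gaussianReal 0 (1 / 2)).prod (gaussianReal 0 (1 / 2))) :=
    (h2.comp_fst _).sub (h2.comp_snd _)
  rw [integral_add hi ((h.mul_prod h).mul_const _),
    integral_sub (h2.comp_fst _) (h2.comp_snd _), integral_mul_const,
    integral_prod_mul (fun x : ℝ => (x : ℂ)) (fun x : ℝ => (x : ℂ)), integral_ofReal_gaussian,
    integral_fun_fst (fun x : ℝ => (x : ℂ) ^ 2), integral_fun_snd (fun x : ℝ => (x : ℂ) ^ 2)]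
  simp

theorem integral_mul_conj_stdComplexGaussian : ∫ z, z * conj z ∂stdComplexGaussian = 1 := by
  rw [stdComplexGaussian, integral_map_equiv]
  simp only [measurableEquivRealProd_symm_eq]
  have h2 := integrable_ofReal_sq_gaussian
  have hexp : ∀ p : ℝ × ℝ, ((p.1 : ℂ) + p.2 * Complex.I) * conj ((p.1 : ℂ) + p.2 * Complex.I) =
      (p.1 : ℂ) ^ 2 + (p.2 : ℂ) ^ 2 := by
    intro p
    simp only [map_add, map_mul, Complex.conj_ofReal, Complex.conj_I]
    linear_combination (-(p.2 : ℂ) ^ 2) * Complex.I_sq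
  simp only [hexp]
  rw [integral_add (h2.comp_fst _) (h2.comp_snd _), integral_fun_fst (fun x : ℝ => (x : ℂ) ^ 2),
    integral_fun_snd (fun x : ℝ => (x : ℂ) ^ 2), integral_ofReal_sq_gaussian]
  norm_num

theorem memLp_id_stdComplexGaussian : MemLp (fun z : ℂ => z) 2 stdComplexGaussian := by
  rw [memLp_two_iff_integrable_sq_norm (by fun_prop), stdComplexGaussian, integrable_map_equiv]
  have h2 := integrable_sq_gaussian
  refine ((h2.comp_fst _).add (h2.comp_snd _)).congr (ae_of_all _ fun p => ?_)
  simp only [Function.comp_apply, Pi.add_apply, ← Complex.normSq_eq_norm_sq, Complex.normSq_apply]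
  simp [Complex.measurableEquivRealProd, sq]

end Moments

section Wave

variable {Ω : Type*} [MeasurableSpace Ω] {P : Measure Ω} {m : ℕ} {a : (Fin 2 → ℤ) → Ω → ℂ}

theorem neg_mem_latticePoints {μ : Fin 2 → ℤ} (hμ : μ ∈ latticePoints m) :
    -μ ∈ latticePoints m := by
  rw [mem_latticePoints] at *
  simpa using hμ

theorem sum_latticePoints_neg {E : Type*} [AddCommMonoid E] (f : (Fin 2 → ℤ) → E) :
    ∑ μ ∈ latticePoints m, f (-μ) = ∑ μ ∈ latticePoints m, f μ :=
  Finset.sum_nbij' (fun μ => -μ) (fun μ => -μ) (fun _ h => neg_mem_latticePoints h)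
    (fun _ h => neg_mem_latticePoints h) (by simp) (by simp) (by simp)

theorem ne_neg_of_mem_latticePoints (hm : m ≠ 0) {μ : Fin 2 → ℤ} (hμ : μ ∈ latticePoints m) :
    μ ≠ -μ := by
  intro h
  have h0 : ∀ i, μ i = 0 := fun i => by
    have := congrFun h i
    simp only [Pi.neg_apply] at this
    omega
  rw [mem_latticePoints, h0, h0] at hμ
  apply hm
  exact_mod_cast hμ.symm

theorem IsWaveCoefficients.memLp (h : IsWaveCoefficients P m a) {μ : Fin 2 → ℤ}
    (hμ : μ ∈ latticePoints m) : MemLp (a μ) 2 P := by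
  have h1 := memLp_id_stdComplexGaussian
  rw [← (h.hasLaw μ hμ).map_eq, memLp_map_measure_iff (by fun_prop) (h.hasLaw μ hμ).aemeasurable]
    at h1
  exact h1

/-- For `ν = -μ` the integrand is almost surely `(a μ)²`, of mean zero. In the remaining
off-diagonal case `{μ, ν}` contains no antipodal pair, so independence and centring apply. -/
theorem IsWaveCoefficients.integral_mul_conj (h : IsWaveCoefficients P m a) (hm : m ≠ 0)
    {μ ν : Fin 2 → ℤ} (hμ : μ ∈ latticePoints m) (hν : ν ∈ latticePoints m) :
    ∫ w, a μ w * conj (a ν w) ∂P = if μ = ν then 1 else 0 := by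
  have hmean : ∫ w, a μ w ∂P = 0 := by
    have := (h.hasLaw μ hμ).integral_comp (f := fun z : ℂ => z) (by fun_prop)
    rw [integral_stdComplexGaussian] at this
    exact this
  split_ifs with heq
  · subst heq
    have := (h.hasLaw μ hμ).integral_comp (f := fun z : ℂ => z * conj z)
      (by fun_prop)
    rw [integral_mul_conj_stdComplexGaussian] at this
    exact this
  by_cases hneg : ν = -μ
  · have hae : (fun w => a μ w * conj (a ν w)) =ᵐ[P] fun w => (a μ w) ^ 2 := by
      filter_upwards [h.neg_eq_conj μ hμ] with w hw
      rw [hneg, hw, Complex.conj_conj, sq]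
    rw [integral_congr_ae hae]
    have := (h.hasLaw μ hμ).integral_comp (f := fun z : ℂ => z ^ 2) (by fun_prop)
    rw [integral_sq_stdComplexGaussian] at this
    exact this
  · have hind := h.indep {μ, ν} (by
        intro x hx
        rcases Finset.mem_insert.mp hx with rfl | hx
        · exact hμ
        · rwa [Finset.mem_singleton.mp hx]) (by
        intro x hx hx'
        simp only [Finset.mem_insert, Finset.mem_singleton] at hx hx'
        rcases hx with rfl | rfl <;> rcases hx' with h' | h'
        · exact ne_neg_of_mem_latticePoints hm hμ h'.symm
        · exact hneg h'.symm
        · exact hneg (by rw [← h', neg_neg])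
        · exact ne_neg_of_mem_latticePoints hm hν h'.symm)
    have hpair : IndepFun (a μ) (a ν) P := hind.indepFun
      (i := ⟨μ, by simp⟩) (j := ⟨ν, by simp⟩) (by simpa using heq)
    have hpair' : IndepFun (a μ) (fun w => conj (a ν w)) P :=
      hpair.comp (φ := id) (ψ := fun z : ℂ => conj z) measurable_id
        (Complex.continuous_conj.measurable)
    rw [hpair'.integral_fun_mul_eq_mul_integral (h.memLp hμ).aestronglyMeasurable
      (Complex.continuous_conj.comp_aestronglyMeasurable (h.memLp hν).aestronglyMeasurable),
      hmean, zero_mul]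

/-- The complex-valued sum of which the wave is the real part. -/
def complexWave (m : ℕ) (a : (Fin 2 → ℤ) → Ω → ℂ) (x : UnitAddTorus (Fin 2)) (w : Ω) : ℂ :=
  ((Real.sqrt (numPoints m) : ℝ) : ℂ)⁻¹ *
    ∑ μ ∈ latticePoints m, a μ w * UnitAddTorus.mFourier μ x

/-- Conjugation permutes the terms by `μ ↦ -μ`, so the complex sum is almost surely real. The
exceptional set comes from the finitely many relations between coefficients and so does not depend
on `x`. -/
theorem IsWaveCoefficients.ae_wave_eq (h : IsWaveCoefficients P m a) :
    ∀ᵐ w ∂P, ∀ x, (wave m a x w : ℂ) = complexWave m a x w := by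
  have hall : ∀ᵐ w ∂P, ∀ μ ∈ latticePoints m, a (-μ) w = conj (a μ w) :=
    (Finset.eventually_all _).mpr h.neg_eq_conj
  filter_upwards [hall] with w hw x
  have hreal : conj (complexWave m a x w) = complexWave m a x w := by
    rw [complexWave, map_mul, map_inv₀, Complex.conj_ofReal, map_sum, ← sum_latticePoints_neg]
    congr 1
    refine Finset.sum_congr rfl fun μ hμ => ?_
    rw [map_mul, hw μ hμ, Complex.conj_conj, UnitAddTorus.mFourier_neg, Complex.conj_conj]
  exact Complex.conj_eq_iff_re.mp hreal

theorem IsWaveCoefficients.integral_wave_mul_wave (h : IsWaveCoefficients P m a) (hm : m ≠ 0)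
    (x y : UnitAddTorus (Fin 2)) :
    ((∫ w, wave m a x w * wave m a y w ∂P : ℝ) : ℂ) = (numPoints m : ℂ)⁻¹ *
      ∑ μ ∈ latticePoints m, UnitAddTorus.mFourier μ x * conj (UnitAddTorus.mFourier μ y) := by
  have hN : ((Real.sqrt (numPoints m) : ℝ) : ℂ)⁻¹ * ((Real.sqrt (numPoints m) : ℝ) : ℂ)⁻¹ =
      (numPoints m : ℂ)⁻¹ := by
    rw [← mul_inv, ← Complex.ofReal_mul, Real.mul_self_sqrt (Nat.cast_nonneg _),
      Complex.ofReal_natCast]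
  have hint : ∀ μ ∈ latticePoints m, ∀ ν ∈ latticePoints m,
      Integrable (fun w => a μ w * conj (a ν w)) P := fun μ hμ ν hν =>
    (h.memLp hμ).integrable_mul ((h.memLp hν).star)
  have hexp : ∀ w, complexWave m a x w * conj (complexWave m a y w) = (numPoints m : ℂ)⁻¹ *
      ∑ μ ∈ latticePoints m, ∑ ν ∈ latticePoints m, a μ w * conj (a ν w) *
        (UnitAddTorus.mFourier μ x * conj (UnitAddTorus.mFourier ν y)) := by
    intro w
    rw [complexWave, complexWave, map_mul, map_inv₀, Complex.conj_ofReal, map_sum, mul_mul_mul_comm,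
      hN, Finset.sum_mul_sum]
    congr 1
    refine Finset.sum_congr rfl fun μ _ => Finset.sum_congr rfl fun ν _ => ?_
    rw [map_mul]
    ring
  have hae : (fun w => ((wave m a x w * wave m a y w : ℝ) : ℂ)) =ᵐ[P]
      fun w => complexWave m a x w * conj (complexWave m a y w) := by
    filter_upwards [h.ae_wave_eq] with w hw
    rw [← hw x, ← hw y, Complex.conj_ofReal, Complex.ofReal_mul]
  rw [← integral_complex_ofReal, integral_congr_ae hae]
  simp only [hexp]
  rw [integral_const_mul, integral_finsetSum _ fun μ hμ => integrable_finsetSum _ fun ν hν =>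
    (hint μ hμ ν hν).mul_const _]
  congr 1
  refine Finset.sum_congr rfl fun μ hμ => ?_
  rw [integral_finsetSum _ fun ν hν => (hint μ hμ ν hν).mul_const _]
  rw [Finset.sum_eq_single μ]
  · rw [integral_mul_const, h.integral_mul_conj hm hμ hμ, if_pos rfl, one_mul]
  · intro ν hν hne
    rw [integral_mul_const, h.integral_mul_conj hm hμ hν, if_neg hne.symm, zero_mul]
  · exact fun hn => absurd hμ hn

end Wave

/-! ### The covariance along the curve as an exponential sum -/

namespace SmoothCurve

variable (c : SmoothCurve)

theorem mFourier_point (μ : Fin 2 → ℤ) (t : ℝ) :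
    UnitAddTorus.mFourier μ (c.point t) = c.expi (toPlane μ) t := by
  simp only [UnitAddTorus.mFourier, point, ContinuousMap.coe_mk, expi, Fin.prod_univ_two,
    fourier_coe_apply, ← Complex.exp_add, PiLp.inner_apply, Fin.sum_univ_two, toPlane,
    RCLike.inner_apply, conj_trivial]
  congr 1
  push_cast
  ring

theorem ofReal_cov {Ω : Type*} [MeasurableSpace Ω] {P : Measure Ω} {m : ℕ}
    {a : (Fin 2 → ℤ) → Ω → ℂ} (h : IsWaveCoefficients P m a) (hm : m ≠ 0) (t₁ t₂ : ℝ) :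
    (c.cov P m a t₁ t₂ : ℂ) = (numPoints m : ℂ)⁻¹ *
      ∑ μ ∈ latticePoints m, c.expi (toPlane μ) t₁ * conj (c.expi (toPlane μ) t₂) := by
  rw [cov, h.integral_wave_mul_wave hm]
  simp only [mFourier_point]

end SmoothCurve

theorem norm_toPlane_of_mem {m : ℕ} {μ : Fin 2 → ℤ} (hμ : μ ∈ latticePoints m) :
    ‖toPlane μ‖ = √(m : ℝ) := by
  have h : sqNorm μ = m := by
    rw [mem_latticePoints, ← sqNorm_cast] at hμ
    exact_mod_cast hμ
  rw [norm_toPlane, h]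

theorem norm_direction_le (μ : Fin 2 → ℤ) : ‖direction μ‖ ≤ 1 := by
  rw [direction, norm_smul, norm_inv, norm_norm]
  exact inv_mul_le_one

theorem inner_toPlane_eq {m : ℕ} (hm : m ≠ 0) {μ : Fin 2 → ℤ} (hμ : μ ∈ latticePoints m)
    (x : EuclideanSpace ℝ (Fin 2)) :
    inner ℝ (toPlane μ) x = √(m : ℝ) * inner ℝ (direction μ) x := by
  have hm' : √(m : ℝ) ≠ 0 := (Real.sqrt_pos.mpr (by positivity)).ne'
  rw [direction, real_inner_smul_left, norm_toPlane_of_mem hμ, ← mul_assoc,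
    mul_inv_cancel₀ hm', one_mul]

theorem one_le_norm_toPlane {v : Fin 2 → ℤ} (hv : v ≠ 0) : 1 ≤ ‖toPlane v‖ := by
  rw [norm_toPlane, Real.one_le_sqrt]
  exact_mod_cast sqNorm_pos hv

/-- The lattice points are invariant under rotation by a right angle, so the average of
`⟨μ/|μ|, e⟩²` is `1/2` for every unit vector `e`. -/
theorem sum_inner_direction_sq {m : ℕ} (hm : m ≠ 0) {e : EuclideanSpace ℝ (Fin 2)}
    (he : ‖e‖ = 1) :
    ∑ μ ∈ latticePoints m, (inner ℝ (direction μ) e) ^ 2 = (numPoints m : ℝ) / 2 := by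
  let rot : (Fin 2 → ℤ) → (Fin 2 → ℤ) := fun μ => ![-μ 1, μ 0]
  have hmem : ∀ μ ∈ latticePoints m, rot μ ∈ latticePoints m := by
    intro μ hμ
    rw [mem_latticePoints] at *
    simp only [rot, Matrix.cons_val_zero, Matrix.cons_val_one]
    linear_combination hμ
  have hinj : Set.InjOn rot (latticePoints m) := by
    intro μ _ ν _ h
    have h0 := congrFun h 0
    have h1 := congrFun h 1
    simp only [rot, Matrix.cons_val_zero, Matrix.cons_val_one, neg_inj] at h0 h1
    ext i
    fin_cases i
    · exact h1
    · exact h0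
  have himg : (latticePoints m).image rot = latticePoints m :=
    Finset.eq_of_subset_of_card_le (Finset.image_subset_iff.mpr hmem)
      (Finset.card_image_of_injOn hinj).ge
  have hrot : ∑ μ ∈ latticePoints m, (inner ℝ (direction (rot μ)) e) ^ 2 =
      ∑ μ ∈ latticePoints m, (inner ℝ (direction μ) e) ^ 2 := by
    conv_rhs => rw [← himg]
    rw [Finset.sum_image hinj]
  -- A direction and its rotation form an orthonormal basis, so the squared components of `e` add up
  -- to `1`.
  have hone : ∀ μ ∈ latticePoints m,
      (inner ℝ (direction μ) e) ^ 2 + (inner ℝ (direction (rot μ)) e) ^ 2 = (1 : ℝ) := by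
    intro μ hμ
    have hm' : (m : ℝ) ≠ 0 := by exact_mod_cast hm
    have hsq : √(m : ℝ) ^ 2 = m := Real.sq_sqrt (Nat.cast_nonneg _)
    have he' : e 0 ^ 2 + e 1 ^ 2 = 1 := by
      have : ‖e‖ ^ 2 = 1 := by rw [he, one_pow]
      rwa [EuclideanSpace.real_norm_sq_eq, Fin.sum_univ_two] at this
    have hμ' : (μ 0 : ℝ) ^ 2 + (μ 1 : ℝ) ^ 2 = m := by
      rw [mem_latticePoints] at hμ
      exact_mod_cast hμ
    have h1 : inner ℝ (toPlane μ) e = μ 0 * e 0 + μ 1 * e 1 := by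
      simp [PiLp.inner_apply, Fin.sum_univ_two, toPlane, mul_comm]
    have h2 : inner ℝ (toPlane (rot μ)) e = -μ 1 * e 0 + μ 0 * e 1 := by
      simp [PiLp.inner_apply, Fin.sum_univ_two, toPlane, rot, mul_comm]
    rw [inner_toPlane_eq hm hμ] at h1
    rw [inner_toPlane_eq hm (hmem μ hμ)] at h2
    apply mul_left_cancel₀ hm'
    have hscale : ∀ x : ℝ, (m : ℝ) * x ^ 2 = (√(m : ℝ) * x) ^ 2 := fun x => by rw [mul_pow, hsq]
    rw [mul_add, hscale, hscale, h1, h2]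
    linear_combination (μ 0 ^ 2 + μ 1 ^ 2 : ℝ) * he' + hμ'
  have h2 := Finset.sum_congr rfl hone
  rw [Finset.sum_add_distrib, hrot, Finset.sum_const, nsmul_eq_mul, mul_one] at h2
  rw [numPoints]
  linarith

/-! ### Mean squares of weighted exponential sums -/

namespace SmoothCurve

variable (c : SmoothCurve)

theorem doubleIntegral_congr {h₁ h₂ : ℝ → ℝ → ℝ}
    (h : ∀ t₁ ∈ Set.Icc 0 c.length, ∀ t₂ ∈ Set.Icc 0 c.length, h₁ t₁ t₂ = h₂ t₁ t₂) :
    c.doubleIntegral h₁ = c.doubleIntegral h₂ := by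
  have hu := Set.uIcc_of_le c.length_pos.le
  refine intervalIntegral.integral_congr fun t₁ ht₁ => intervalIntegral.integral_congr
    fun t₂ ht₂ => ?_
  rw [hu] at ht₁ ht₂
  exact h t₁ ht₁ t₂ ht₂

theorem expi_mul_conj_expi (μ ν : Fin 2 → ℤ) (t : ℝ) :
    c.expi (toPlane μ) t * conj (c.expi (toPlane ν) t) = c.expi (toPlane (μ - ν)) t := by
  have h : toPlane (μ - ν) = toPlane μ - toPlane ν := by
    ext i
    simp [toPlane]
  rw [expi, expi, expi, ← Complex.exp_conj, ← Complex.exp_add, h, inner_sub_left]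
  congr 1
  simp only [map_mul, Complex.conj_ofReal, Complex.conj_I]
  push_cast
  ring

/-- The weighted exponential sum `N⁻¹ ∑ f_μ(t₁) g_μ(t₂) e^{2πi⟨μ, γ(t₁) - γ(t₂)⟩}`. -/
def kernel (m : ℕ) (f g : (Fin 2 → ℤ) → ℝ → ℝ) (t₁ t₂ : ℝ) : ℂ :=
  (numPoints m : ℂ)⁻¹ * ∑ μ ∈ latticePoints m,
    (f μ t₁ : ℂ) * c.expi (toPlane μ) t₁ * conj ((g μ t₂ : ℂ) * c.expi (toPlane μ) t₂)

theorem norm_kernel_sq (m : ℕ) (f g : (Fin 2 → ℤ) → ℝ → ℝ) (t₁ t₂ : ℝ) :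
    ((‖c.kernel m f g t₁ t₂‖ ^ 2 : ℝ) : ℂ) = ∑ q ∈ latticePoints m ×ˢ latticePoints m,
      (numPoints m : ℂ)⁻¹ ^ 2 *
      (((f q.1 t₁ * f q.2 t₁ : ℝ) : ℂ) * c.expi (toPlane (q.1 - q.2)) t₁) *
      conj (((g q.1 t₂ * g q.2 t₂ : ℝ) : ℂ) * c.expi (toPlane (q.1 - q.2)) t₂) := by
  rw [Complex.ofReal_pow, ← Complex.mul_conj', kernel, map_mul, map_inv₀, map_sum,
    Complex.conj_natCast, mul_mul_mul_comm, Finset.sum_mul_sum, Finset.sum_product, Finset.mul_sum]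
  refine Finset.sum_congr rfl fun μ _ => ?_
  rw [Finset.mul_sum]
  refine Finset.sum_congr rfl fun ν _ => ?_
  simp only [← expi_mul_conj_expi, map_mul, Complex.conj_conj, Complex.conj_ofReal,
    Complex.ofReal_mul]
  ring

/-- Each term of the expanded square is a function of `t₁` times a function of `t₂`, so the double
integral factors into two oscillatory integrals of frequency `μ - ν`. -/
theorem doubleIntegral_norm_kernel_sq {m : ℕ} {f g : (Fin 2 → ℤ) → ℝ → ℝ}
    (hf : ∀ μ ∈ latticePoints m, ContinuousOn (f μ) (Set.Icc 0 c.length))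
    (hg : ∀ μ ∈ latticePoints m, ContinuousOn (g μ) (Set.Icc 0 c.length)) :
    (c.doubleIntegral (fun t₁ t₂ => ‖c.kernel m f g t₁ t₂‖ ^ 2) : ℂ) =
      (numPoints m : ℂ)⁻¹ ^ 2 * ∑ q ∈ latticePoints m ×ˢ latticePoints m,
        c.osc (toPlane (q.1 - q.2)) (fun t => f q.1 t * f q.2 t) *
          conj (c.osc (toPlane (q.1 - q.2)) (fun t => g q.1 t * g q.2 t)) := by
  have hL := c.length_pos.le
  have hcont : ∀ {h : (Fin 2 → ℤ) → ℝ → ℝ},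
      (∀ μ ∈ latticePoints m, ContinuousOn (h μ) (Set.Icc 0 c.length)) →
      ∀ q ∈ latticePoints m ×ˢ latticePoints m, ContinuousOn (fun t =>
        ((h q.1 t * h q.2 t : ℝ) : ℂ) * c.expi (toPlane (q.1 - q.2)) t) (Set.Icc 0 c.length) := by
    intro h hh q hq
    rw [Finset.mem_product] at hq
    exact (Complex.continuous_ofReal.comp_continuousOn ((hh _ hq.1).mul (hh _ hq.2))).mul
      (c.continuousOn_expi _)
  rw [doubleIntegral, ← intervalIntegral.integral_ofReal]
  simp only [← intervalIntegral.integral_ofReal, norm_kernel_sq]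
  have hinner : ∀ t₁ : ℝ, (∫ t₂ in (0 : ℝ)..c.length,
      ∑ q ∈ latticePoints m ×ˢ latticePoints m, (numPoints m : ℂ)⁻¹ ^ 2 *
      (((f q.1 t₁ * f q.2 t₁ : ℝ) : ℂ) * c.expi (toPlane (q.1 - q.2)) t₁) *
      conj (((g q.1 t₂ * g q.2 t₂ : ℝ) : ℂ) * c.expi (toPlane (q.1 - q.2)) t₂)) =
      ∑ q ∈ latticePoints m ×ˢ latticePoints m, (numPoints m : ℂ)⁻¹ ^ 2 *
      (((f q.1 t₁ * f q.2 t₁ : ℝ) : ℂ) * c.expi (toPlane (q.1 - q.2)) t₁) *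
      conj (c.osc (toPlane (q.1 - q.2)) (fun t => g q.1 t * g q.2 t)) := by
    intro t₁
    rw [intervalIntegral.integral_finsetSum]
    · refine Finset.sum_congr rfl fun q _ => ?_
      rw [intervalIntegral.integral_const_mul, intervalIntegral.intervalIntegral_conj, osc]
    · exact fun q hq => ContinuousOn.intervalIntegrable_of_Icc hL
        (continuousOn_const.mul (Complex.continuous_conj.comp_continuousOn (hcont hg q hq)))
  simp only [hinner]
  rw [intervalIntegral.integral_finsetSum, Finset.mul_sum]
  · refine Finset.sum_congr rfl fun q _ => ?_
    rw [intervalIntegral.integral_mul_const, intervalIntegral.integral_const_mul, osc, osc,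
      mul_assoc]
  · exact fun q hq => ContinuousOn.intervalIntegrable_of_Icc hL
      ((continuousOn_const.mul (hcont hf q hq)).mul continuousOn_const)

theorem osc_zero (A : ℝ → ℝ) :
    c.osc (toPlane 0) A = ((∫ t in (0 : ℝ)..c.length, A t : ℝ) : ℂ) := by
  have h : toPlane 0 = 0 := by
    ext i
    simp [toPlane]
  rw [osc, h, ← intervalIntegral.integral_ofReal]
  simp [expi]

/-- The mean square of a weighted exponential sum is given by its diagonal terms. -/
theorem exists_abs_doubleIntegral_norm_kernel_sq_sub_le
    (hcurv : ∀ t ∈ Set.Icc 0 c.length, c.curvature t ≠ 0) {ε : ℝ} (hε : 0 < ε) {M : ℝ}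
    (hM : 0 ≤ M) :
    ∃ K : ℝ, ∀ m : ℕ, m ≠ 0 → (latticePoints m).Nonempty → ∀ f g : (Fin 2 → ℤ) → ℝ → ℝ,
      (∀ μ ∈ latticePoints m, IsAmplitude c.length M (f μ)) →
      (∀ μ ∈ latticePoints m, IsAmplitude c.length M (g μ)) →
      |c.doubleIntegral (fun t₁ t₂ => ‖c.kernel m f g t₁ t₂‖ ^ 2) -
        ((numPoints m : ℝ) ^ 2)⁻¹ * ∑ μ ∈ latticePoints m,
          (∫ t in (0 : ℝ)..c.length, f μ t ^ 2) * ∫ t in (0 : ℝ)..c.length, g μ t ^ 2| ≤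
        K * (numPoints m : ℝ) ^ (-2 + ε) := by
  -- The amplitudes that occur are products of two, whose derivatives are bounded by `2 * M`.
  obtain ⟨C, hC, hosc⟩ := c.exists_norm_osc_le hcurv (mul_nonneg zero_le_two hM)
  obtain ⟨K, hK, hsum⟩ := exists_sum_inv_norm_sub_le hε
  refine ⟨C ^ 2 * K, fun m hm hne f g hf hg => ?_⟩
  have hN : (0 : ℝ) < numPoints m := by exact_mod_cast Finset.card_pos.mpr hne
  rw [← Real.norm_eq_abs, ← Complex.norm_real, Complex.ofReal_sub,
    c.doubleIntegral_norm_kernel_sq (fun μ hμ => (hf μ hμ).1) (fun μ hμ => (hg μ hμ).1),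
    ← Finset.diag_union_offDiag, Finset.sum_union (Finset.disjoint_diag_offDiag _),
    Finset.sum_diag]
  have hdiag : ∀ μ ∈ latticePoints m, c.osc (toPlane (μ - μ)) (fun t => f μ t * f μ t) *
      conj (c.osc (toPlane (μ - μ)) (fun t => g μ t * g μ t)) =
      (((∫ t in (0 : ℝ)..c.length, f μ t ^ 2) * ∫ t in (0 : ℝ)..c.length, g μ t ^ 2 : ℝ) : ℂ) := by
    intro μ _
    rw [sub_self, osc_zero, osc_zero, Complex.conj_ofReal, Complex.ofReal_mul]
    simp only [sq]
  rw [Finset.sum_congr rfl hdiag]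
  have hcancel : ∀ S T : ℂ, (numPoints m : ℂ)⁻¹ ^ 2 * (S + T) - ((numPoints m : ℂ) ^ 2)⁻¹ * S =
      ((numPoints m : ℂ) ^ 2)⁻¹ * T := by
    intro S T
    rw [inv_pow]
    ring
  rw [Complex.ofReal_mul, Complex.ofReal_inv, Complex.ofReal_pow, Complex.ofReal_natCast,
    Complex.ofReal_sum, hcancel, norm_mul, norm_inv, norm_pow, Complex.norm_natCast]
  have hoff : ‖∑ q ∈ (latticePoints m).offDiag,
      c.osc (toPlane (q.1 - q.2)) (fun t => f q.1 t * f q.2 t) *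
        conj (c.osc (toPlane (q.1 - q.2)) (fun t => g q.1 t * g q.2 t))‖ ≤
      C ^ 2 * (K * (numPoints m : ℝ) ^ ε) := by
    refine (norm_sum_le _ _).trans (le_trans (Finset.sum_le_sum fun q hq => ?_)
      ((Finset.mul_sum _ _ _).symm.le.trans
        (mul_le_mul_of_nonneg_left (hsum m hm hne) (sq_nonneg C))))
    rw [Finset.mem_offDiag] at hq
    have h1 := one_le_norm_toPlane (sub_ne_zero.mpr hq.2.2)
    rw [norm_mul, RCLike.norm_conj]
    calc _ ≤ (C / √‖toPlane (q.1 - q.2)‖) * (C / √‖toPlane (q.1 - q.2)‖) :=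
          mul_le_mul (hosc _ h1 _ ((hf _ hq.1).mul (hf _ hq.2.1)))
            (hosc _ h1 _ ((hg _ hq.1).mul (hg _ hq.2.1))) (norm_nonneg _) (by positivity)
      _ = _ := by
        rw [div_mul_div_comm, Real.mul_self_sqrt (norm_nonneg _), div_eq_mul_inv, sq]
  calc _ ≤ ((numPoints m : ℝ) ^ 2)⁻¹ * (C ^ 2 * (K * (numPoints m : ℝ) ^ ε)) := by gcongr
    _ = _ := by
      rw [Real.rpow_add hN, Real.rpow_neg hN.le, Real.rpow_two]
      ring

/-! ### Derivatives of the covariance as weighted exponential sums -/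

section Derivatives

theorem hasDerivWithinAt_expi (v : EuclideanSpace ℝ (Fin 2)) {t : ℝ}
    (ht : t ∈ Set.Icc 0 c.length) :
    HasDerivWithinAt (c.expi v)
      ((2 * Real.pi * inner ℝ v (c.velocity t) : ℝ) * Complex.I * c.expi v t)
      (Set.Icc 0 c.length) t := by
  have h1 : HasDerivWithinAt (fun s => inner ℝ v (c.lift s)) (inner ℝ v (c.velocity t))
      (Set.Icc 0 c.length) t :=
    (innerSL ℝ v).hasFDerivAt.comp_hasDerivWithinAt t (c.hasDerivWithinAt_lift ht)
  convert! ((h1.const_mul (2 * Real.pi)).ofReal_comp.mul_const Complex.I).cexp using 1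
  rw [expi]
  ring

theorem ofReal_derivWithin {f : ℝ → ℝ} {f' : ℂ} {t : ℝ} (ht : t ∈ Set.Icc 0 c.length)
    (h : HasDerivWithinAt (fun s => (f s : ℂ)) f' (Set.Icc 0 c.length) t) :
    ((derivWithin f (Set.Icc 0 c.length) t : ℝ) : ℂ) = f' := by
  have h1 : HasDerivWithinAt f f'.re (Set.Icc 0 c.length) t :=
    Complex.reCLM.hasFDerivAt.comp_hasDerivWithinAt t h
  rw [h1.derivWithin (c.uniqueDiffOn t ht)]
  exact (c.uniqueDiffOn t ht).eq_deriv _ h1.ofReal_comp h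

variable {Ω : Type*} [MeasurableSpace Ω] {P : Measure Ω} {m : ℕ} {a : (Fin 2 → ℤ) → Ω → ℂ}

theorem ofReal_partial₁_cov (h : IsWaveCoefficients P m a) (hm : m ≠ 0) {t₁ : ℝ}
    (ht₁ : t₁ ∈ Set.Icc 0 c.length) (t₂ : ℝ) :
    (c.partial₁ (c.cov P m a) t₁ t₂ : ℂ) = (numPoints m : ℂ)⁻¹ * ∑ μ ∈ latticePoints m,
      (2 * Real.pi * inner ℝ (toPlane μ) (c.velocity t₁) : ℝ) * Complex.I *
        c.expi (toPlane μ) t₁ * conj (c.expi (toPlane μ) t₂) := by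
  refine c.ofReal_derivWithin ht₁ ?_
  simp only [c.ofReal_cov h hm]
  exact (HasDerivWithinAt.fun_sum fun μ _ =>
    (c.hasDerivWithinAt_expi (toPlane μ) ht₁).mul_const _).const_mul _

theorem ofReal_partial₂_cov (h : IsWaveCoefficients P m a) (hm : m ≠ 0) (t₁ : ℝ) {t₂ : ℝ}
    (ht₂ : t₂ ∈ Set.Icc 0 c.length) :
    (c.partial₂ (c.cov P m a) t₁ t₂ : ℂ) = (numPoints m : ℂ)⁻¹ * ∑ μ ∈ latticePoints m,
      c.expi (toPlane μ) t₁ * conj ((2 * Real.pi * inner ℝ (toPlane μ) (c.velocity t₂) : ℝ) *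
        Complex.I * c.expi (toPlane μ) t₂) := by
  refine c.ofReal_derivWithin ht₂ ?_
  simp only [c.ofReal_cov h hm]
  exact (HasDerivWithinAt.fun_sum fun μ _ =>
    (c.hasDerivWithinAt_expi (toPlane μ) ht₂).star.const_mul _).const_mul _

theorem ofReal_partial₁_partial₂_cov (h : IsWaveCoefficients P m a) (hm : m ≠ 0) {t₁ t₂ : ℝ}
    (ht₁ : t₁ ∈ Set.Icc 0 c.length) (ht₂ : t₂ ∈ Set.Icc 0 c.length) :
    (c.partial₁ (c.partial₂ (c.cov P m a)) t₁ t₂ : ℂ) =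
      (numPoints m : ℂ)⁻¹ * ∑ μ ∈ latticePoints m,
      (2 * Real.pi * inner ℝ (toPlane μ) (c.velocity t₁) : ℝ) * Complex.I *
        c.expi (toPlane μ) t₁ * conj ((2 * Real.pi * inner ℝ (toPlane μ) (c.velocity t₂) : ℝ) *
        Complex.I * c.expi (toPlane μ) t₂) := by
  refine c.ofReal_derivWithin ht₁ ?_
  simp only [c.ofReal_partial₂_cov h hm _ ht₂]
  exact (HasDerivWithinAt.fun_sum fun μ _ =>
    (c.hasDerivWithinAt_expi (toPlane μ) ht₁).mul_const _).const_mul _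

/-- The amplitude `⟨μ/|μ|, γ̇(t)⟩`. -/
def slope (μ : Fin 2 → ℤ) (t : ℝ) : ℝ := inner ℝ (direction μ) (c.velocity t)

theorem cov_sq_eq (h : IsWaveCoefficients P m a) (hm : m ≠ 0) (t₁ t₂ : ℝ) :
    c.cov P m a t₁ t₂ ^ 2 = ‖c.kernel m (fun _ _ => 1) (fun _ _ => 1) t₁ t₂‖ ^ 2 := by
  rw [← sq_abs, ← Real.norm_eq_abs, ← Complex.norm_real, c.ofReal_cov h hm, kernel]
  simp only [Complex.ofReal_one, one_mul]

theorem partial₁_cov_sq_eq (h : IsWaveCoefficients P m a) (hm : m ≠ 0) {t₁ : ℝ}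
    (ht₁ : t₁ ∈ Set.Icc 0 c.length) (t₂ : ℝ) :
    |1 / (2 * Real.pi * Real.sqrt m) * c.partial₁ (c.cov P m a) t₁ t₂| ^ 2 =
      ‖c.kernel m c.slope (fun _ _ => 1) t₁ t₂‖ ^ 2 := by
  have hs : (√(m : ℝ) : ℂ) ≠ 0 := by
    exact_mod_cast (Real.sqrt_pos.mpr (by positivity : (0 : ℝ) < m)).ne'
  have hpi : (Real.pi : ℂ) ≠ 0 := by exact_mod_cast Real.pi_ne_zero
  -- Differentiation produces `2πi⟨μ, γ̇⟩`. The normalization turns `μ` into `μ/|μ|`, and the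
  -- leftover `i` has modulus one.
  have hkey : ((1 / (2 * Real.pi * Real.sqrt m) * c.partial₁ (c.cov P m a) t₁ t₂ : ℝ) : ℂ) =
      Complex.I * c.kernel m c.slope (fun _ _ => 1) t₁ t₂ := by
    rw [Complex.ofReal_mul, c.ofReal_partial₁_cov h hm ht₁, kernel, mul_left_comm,
      mul_left_comm Complex.I]
    congr 1
    rw [Finset.mul_sum, Finset.mul_sum]
    refine Finset.sum_congr rfl fun μ hμ => ?_
    rw [inner_toPlane_eq hm hμ, slope]
    push_cast
    field_simp
  rw [← Real.norm_eq_abs, ← Complex.norm_real, hkey, norm_mul, Complex.norm_I, one_mul]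

theorem partial₁_partial₂_cov_sq_eq (h : IsWaveCoefficients P m a) (hm : m ≠ 0) {t₁ t₂ : ℝ}
    (ht₁ : t₁ ∈ Set.Icc 0 c.length) (ht₂ : t₂ ∈ Set.Icc 0 c.length) :
    |1 / (4 * Real.pi ^ 2 * m) * c.partial₁ (c.partial₂ (c.cov P m a)) t₁ t₂| ^ 2 =
      ‖c.kernel m c.slope c.slope t₁ t₂‖ ^ 2 := by
  have hs2 : (m : ℂ) = (√(m : ℝ) : ℂ) ^ 2 := by
    rw [← Complex.ofReal_pow, Real.sq_sqrt (Nat.cast_nonneg m), Complex.ofReal_natCast]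
  have hs : (√(m : ℝ) : ℂ) ≠ 0 := by
    exact_mod_cast (Real.sqrt_pos.mpr (by positivity : (0 : ℝ) < m)).ne'
  have hpi : (Real.pi : ℂ) ≠ 0 := by exact_mod_cast Real.pi_ne_zero
  have hkey : ((1 / (4 * Real.pi ^ 2 * m) * c.partial₁ (c.partial₂ (c.cov P m a)) t₁ t₂ : ℝ) : ℂ) =
      c.kernel m c.slope c.slope t₁ t₂ := by
    rw [Complex.ofReal_mul, c.ofReal_partial₁_partial₂_cov h hm ht₁ ht₂, kernel, mul_left_comm,
      Finset.mul_sum]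
    refine congrArg _ (Finset.sum_congr rfl fun μ hμ => ?_)
    rw [inner_toPlane_eq hm hμ, inner_toPlane_eq hm hμ, ← slope, ← slope]
    simp only [map_mul, Complex.conj_ofReal, Complex.conj_I]
    push_cast
    rw [hs2]
    field_simp
    linear_combination (-4 * (c.slope μ t₁ : ℂ) * c.expi (toPlane μ) t₁ * c.slope μ t₂ *
      conj (c.expi (toPlane μ) t₂)) * Complex.I_sq
  rw [← Real.norm_eq_abs, ← Complex.norm_real, hkey]

end Derivatives

/-! ### Evaluation of the diagonal terms -/

section MainTerms

theorem continuousOn_slope (μ : Fin 2 → ℤ) : ContinuousOn (c.slope μ) (Set.Icc 0 c.length) :=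
  ContinuousOn.inner (𝕜 := ℝ) continuousOn_const c.contDiffOn_velocity.continuousOn

theorem sum_integral_slope_sq {m : ℕ} (hm : m ≠ 0) :
    ∑ μ ∈ latticePoints m, ∫ t in (0 : ℝ)..c.length, c.slope μ t ^ 2 =
      (numPoints m : ℝ) / 2 * c.length := by
  have hi : ∀ μ, IntervalIntegrable (fun t => c.slope μ t ^ 2) volume 0 c.length := fun μ =>
    ((c.continuousOn_slope μ).pow 2).intervalIntegrable_of_Icc c.length_pos.le
  rw [← intervalIntegral.integral_finsetSum fun μ _ => hi μ]
  have h : ∫ t in (0 : ℝ)..c.length, ∑ μ ∈ latticePoints m, c.slope μ t ^ 2 =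
      ∫ t in (0 : ℝ)..c.length, (numPoints m : ℝ) / 2 := by
    refine intervalIntegral.integral_congr fun t ht => ?_
    rw [Set.uIcc_of_le c.length_pos.le] at ht
    exact sum_inner_direction_sq hm (c.norm_velocity ht)
  rw [h, intervalIntegral.integral_const, smul_eq_mul, sub_zero, mul_comm]

theorem B_eq (m : ℕ) :
    c.B m = 1 / (numPoints m : ℝ) * ∑ μ ∈ latticePoints m,
      (∫ t in (0 : ℝ)..c.length, c.slope μ t ^ 2) * ∫ t in (0 : ℝ)..c.length, c.slope μ t ^ 2 := by
  have hi : ∀ μ, IntervalIntegrable (fun t => c.slope μ t ^ 2) volume 0 c.length := fun μ =>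
    ((c.continuousOn_slope μ).pow 2).intervalIntegrable_of_Icc c.length_pos.le
  rw [B, doubleIntegral]
  have hslope : ∀ μ t, inner ℝ (direction μ) (c.velocity t) = c.slope μ t := fun _ _ => rfl
  simp only [hslope, intervalIntegral.integral_const_mul]
  congr 1
  have hinner : ∀ t₁ : ℝ, (∫ t₂ in (0 : ℝ)..c.length, ∑ μ ∈ latticePoints m,
      c.slope μ t₁ ^ 2 * c.slope μ t₂ ^ 2) = ∑ μ ∈ latticePoints m,
      c.slope μ t₁ ^ 2 * ∫ t₂ in (0 : ℝ)..c.length, c.slope μ t₂ ^ 2 := by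
    intro t₁
    rw [intervalIntegral.integral_finsetSum fun μ _ => (hi μ).const_mul _]
    simp only [intervalIntegral.integral_const_mul]
  simp only [hinner]
  rw [intervalIntegral.integral_finsetSum fun μ _ => (hi μ).mul_const _]
  simp only [intervalIntegral.integral_mul_const]

end MainTerms

end SmoothCurve

end NodalTorus

end

/-! ### The three asymptotic formulas -/

theorem proposition5p1 (c : NodalTorus.SmoothCurve)
    (hcurv : ∀ t ∈ Set.Icc 0 c.length, c.curvature t ≠ 0) (ε : ℝ) (hε : 0 < ε) :
    ∃ K : ℝ, ∀ m : ℕ, 0 < m → (NodalTorus.latticePoints m).Nonempty →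
      ∀ (Ω : Type*) [MeasurableSpace Ω] (P : MeasureTheory.Measure Ω)
        [MeasureTheory.IsProbabilityMeasure P] (a : (Fin 2 → ℤ) → Ω → ℂ),
        NodalTorus.IsWaveCoefficients P m a →
        |c.doubleIntegral (fun t₁ t₂ => (c.cov P m a t₁ t₂) ^ 2)
            - c.length ^ 2 / (NodalTorus.numPoints m : ℝ)|
          ≤ K * (NodalTorus.numPoints m : ℝ) ^ (-2 + ε) ∧
        |c.doubleIntegral (fun t₁ t₂ =>
              |1 / (2 * Real.pi * Real.sqrt m) * c.partial₁ (c.cov P m a) t₁ t₂| ^ 2)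
            - c.length ^ 2 / (2 * (NodalTorus.numPoints m : ℝ))|
          ≤ K * (NodalTorus.numPoints m : ℝ) ^ (-2 + ε) ∧
        |c.doubleIntegral (fun t₁ t₂ =>
              |1 / (4 * Real.pi ^ 2 * m) * c.partial₁ (c.partial₂ (c.cov P m a)) t₁ t₂| ^ 2)
            - c.B m / (NodalTorus.numPoints m : ℝ)|
          ≤ K * (NodalTorus.numPoints m : ℝ) ^ (-2 + ε) := by
  obtain ⟨M, hM, hslope⟩ := c.exists_isAmplitude_inner_velocity
  obtain ⟨K, hK⟩ := c.exists_abs_doubleIntegral_norm_kernel_sq_sub_le hcurv hε hM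
  refine ⟨K, fun m hm hne Ω _ P _ a ha => ?_⟩
  have hm0 := hm.ne'
  have hN : (NodalTorus.numPoints m : ℝ) ≠ 0 := by exact_mod_cast (Finset.card_pos.mpr hne).ne'
  have hone : ∀ μ ∈ NodalTorus.latticePoints m,
      NodalTorus.IsAmplitude c.length M ((fun _ _ => 1 : (Fin 2 → ℤ) → ℝ → ℝ) μ) :=
    fun _ _ => NodalTorus.isAmplitude_one hM
  have hsl : ∀ μ ∈ NodalTorus.latticePoints m, NodalTorus.IsAmplitude c.length M (c.slope μ) :=
    fun μ _ => hslope _ (NodalTorus.norm_direction_le μ)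
  have hlen : ∫ _ in (0 : ℝ)..c.length, (1 : ℝ) ^ 2 = c.length := by simp
  -- The amplitude pairs are `(1, 1)`, `(slope, 1)` and `(slope, slope)`. The diagonals are
  -- evaluated by the length alone, by the mean `1/2` of the squared slopes, and by factoring the
  -- integral defining `B`.
  refine ⟨?_, ?_, ?_⟩
  · have h := hK m hm0 hne _ _ hone hone
    rw [c.doubleIntegral_congr fun t₁ _ t₂ _ => c.cov_sq_eq ha hm0 t₁ t₂]
    convert! h using 3
    simp only [hlen, Finset.sum_const, nsmul_eq_mul]
    rw [← NodalTorus.numPoints]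
    field_simp
  · have h := hK m hm0 hne _ _ hsl hone
    rw [c.doubleIntegral_congr fun t₁ ht₁ t₂ _ => c.partial₁_cov_sq_eq ha hm0 ht₁ t₂]
    convert! h using 3
    simp only [hlen]
    rw [← Finset.sum_mul, c.sum_integral_slope_sq hm0]
    field_simp
  · have h := hK m hm0 hne _ _ hsl hsl
    rw [c.doubleIntegral_congr fun t₁ ht₁ t₂ ht₂ =>
      c.partial₁_partial₂_cov_sq_eq ha hm0 ht₁ ht₂]
    convert! h using 3
    rw [c.B_eq]
    field_simp
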